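/- **Setting.** Let $\mathbb T=(T,V,\xi)$ be a strict topological theory: $V=(V,\otimes,k)$ is a commutative quantale; $T=(T,e,m)$ is a monad on $\mathbf{Set}$ such that $T$ sends pullbacks to weak pullbacks and every naturality square of $m$ is a weak pullback; $\xi:TV\to V$ is a $T$-algebra structure for which $\otimes:V\times V\to V$ and $k:1\to V$ are $T$-homomorphisms and for which the maps $\xi_X:V^X\to V^{TX}$, $\varphi\mapsto\xi\cdot T\varphi$, are monotone and form a natural transformation $P\to PT$, where $PX=V^X$ and $Pf(\varphi)(y)=\bigvee_{f(x)=y}\varphi(x)$. For $r:X\times Y\to V$ put $T_\xi r(\mathfrak x,\mathfrak y)=\bigvee\{\xi(Tr(\mathfrak w))\mid \mathfrak w\in T(X\times Y),\ T\pi_1\mathfrak w=\mathfrak x,\ T\pi_2\mathfrak w=\mathfrak y\}$. A $\mathbb T$-relation $\alpha:X\rightharpoonup Y$ is a map $TX\times Y\to V$; composition is $\beta\circ\alpha=\beta\cdot T_\xi\alpha\cdot m_X^\circ$, i.e. $(\beta\circ\alpha)(\mathfrak x,z)=\bigvee_{m_X(\mathfrak X)=\mathfrak x,\ \mathfrak y\in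 TY}T_\xi\alpha(\mathfrak X,\mathfrak y)\otimes\beta(\mathfrak y,z)$. Given $\alpha:X\rightharpoonup Y$, the map $-\circ\alpha$ has a right adjoint $\gamma\mapsto\gamma/\alpha$. A $\mathbb T$-category is a set $X$ with $a:X\rightharpoonup X$ satisfying $e_X^\circ\le a$ and $a\circ a\le a$; a $\mathbb T$-functor $f:(X,a)\to(Y,b)$ is a map with $a(\mathfrak x,x)\le b(Tf(\mathfrak x),f(x))$. These form the category $\mathbf{Cat}(\mathbb T)$. A $\mathbb T$-distributor $(X,a)\rightharpoonup(Y,b)$ is a $\mathbb T$-relation $\varphi$ with $\varphi\circ a\le\varphi$ and $b\circ\varphi\le\varphi$. A $\mathbb T$-functor $f$ induces distributors $f_*(\mathfrak x,y)=b(Tf(\mathfrak x),y)$ and $f^*(\mathfrak y,x)=b(\mathfrak y,f(x))$. Put $f\le g$ iff $f^*\le g^*$; write $f\dashv g$ iff $1\le gf$ and $fg\le 1$. $X$ is separated if, for all $f,g:Y\to X$, $f\le g\le f$ implies $f=g$. Let $G=(1,e_1^\circ)$. Let $\Phi$ be a class of $\mathbb T$-distributors such that: (1) $f^*\in\Phi$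 for every $\mathbb T$-functor $f$; (2) whenever $\varphi\in\Phi$, $f$ is a $\mathbb T$-functor and the compositions are defined, $f^*\circ\varphi\in\Phi$, $\varphi\circ f^*\in\Phi$, and $f_*\in\Phi$ implies $\varphi\circ f_*\in\Phi$; (3) a distributor $\varphi:X\rightharpoonup Y$ is in $\Phi$ as soon as $y^*\circ\varphi\in\Phi$ for every point $y:G\to Y$. A $\mathbb T$-functor $g:Z\to X$ is a colimit of $h:Y\to X$ weighted by $\varphi:Y\rightharpoonup Z$ if $g_*=h_*/\varphi$. $X$ is $\Phi$-cocomplete if all colimits weighted by members of $\Phi$ exist in $X$; a $\mathbb T$-functor is $\Phi$-cocontinuous if it preserves all existing colimits weighted by members of $\Phi$. Let $\mathbf{Cocont}^\Phi_{sep}(\mathbb T)$ be the category of separated $\Phi$-cocomplete $\mathbb T$-categories and $\Phi$-cocontinuous $\mathbb T$-functors. Let $PX$ be the set of all distributors $\psi:X\rightharpoonup G$ with structure $[\mathfrak p,\psi]=\bigwedge\{\hom(\xi(T\mathrm{ev}(\mathfrak q)),\psi(m_X(T\pi_1\mathfrak q)))\mid \mathfrak q\in T(TX\times PX),\ T\pi_2\mathfrak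 q=\mathfrak p\}$; let $\Phi X=\{\psi\in PX\mid\psi\in\Phi\}$ with the restricted structure, $y^\Phi_X:X\to\Phi X$, $x\mapsto a(-,x)$, and, for $f:X\to Y$, $\Phi f:\Phi X\to\Phi Y$, $\psi\mapsto\psi\circ f^*$. **Statement.** (a) Each $\Phi X$ is separated and $\Phi$-cocomplete, each $\Phi f$ is $\Phi$-cocontinuous, and the functor $\Phi:\mathbf{Cat}(\mathbb T)\to\mathbf{Cocont}^\Phi_{sep}(\mathbb T)$ so obtained is left adjoint to the inclusion $\mathbf{Cocont}^\Phi_{sep}(\mathbb T)\to\mathbf{Cat}(\mathbb T)$, with unit $y^\Phi$. Thus $\mathbf{Cocont}^\Phi_{sep}(\mathbb T)$ is a reflective subcategory of $\mathbf{Cat}(\mathbb T)$ which is not full in general: there are $\mathbb T$ and $\Phi$ for which the inclusion is not full. (b) The multiplication of the induced monad on $\mathbf{Cat}(\mathbb T)$ is $(y^\Phi_X)^{-1}:\Phi\Phi X\to\Phi X$, $\Psi\mapsto\Psi\circ(y^\Phi_X)_*$. This monad $(\Phi,y^\Phi,(y^\Phi)^{-1})$ is of Kock–Zöberlein type: $f\le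 g$ implies $\Phi f\le\Phi g$, and $\Phi y^\Phi_X\dashv(y^\Phi_X)^{-1}\dashv y^\Phi_{\Phi X}$ for every $X$. (c) The comparison functor from $\mathbf{Cocont}^\Phi_{sep}(\mathbb T)$ to the category of Eilenberg–Moore algebras of this monad is an equivalence of categories. -/

import Mathlib

open CategoryTheory

universe u

/-! ### `V`-relations -/

section VRelations

variable {V : Type u} [CommMonoid V] [CompleteLattice V] [IsQuantale V]

/-- The internal hom of the quantale: `w ≤ vhom u v ↔ w * u ≤ v`. -/
def vhom (u v : V) : V := Quantale.leftMulResiduation u v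

theorem le_vhom {u v w : V} : w ≤ vhom u v ↔ w * u ≤ v :=
  Quantale.leftMulResiduation_le_iff_mul_le

theorem q_mul_iSup {ι : Sort*} (x : V) (f : ι → V) : x * ⨆ i, f i = ⨆ i, x * f i := by
  rw [iSup, mul_sSup_distrib, iSup_range]

theorem q_iSup_mul {ι : Sort*} (f : ι → V) (x : V) : (⨆ i, f i) * x = ⨆ i, f i * x := by
  rw [iSup, sSup_mul_distrib, iSup_range]

/-- `V`-relations from `X` to `Y`, ordered pointwise. -/
abbrev VRel (V : Type u) (X Y : Type u) : Type u := X → Y → V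

/-- Composition `s · r` of `V`-relations. -/
def VRel.comp {X Y Z : Type u} (s : VRel V Y Z) (r : VRel V X Y) : VRel V X Z :=
  fun x z => ⨆ y, r x y * s y z

/-- The converse `r°`. -/
def VRel.conv {X Y : Type u} (r : VRel V X Y) : VRel V Y X := fun y x => r x y

/-- The graph of a map, as a `V`-relation with values `k` and `⊥`. -/
def VRel.graph (V : Type u) [CommMonoid V] [CompleteLattice V] {X Y : Type u} (f : X → Y) :
    VRel V X Y := fun x y => ⨆ _ : f x = y, (1 : V)

/-- The extension of `t` along `r`, right adjoint to `s ↦ s · r`. -/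
def VRel.ext {X Y Z : Type u} (t : VRel V X Z) (r : VRel V X Y) : VRel V Y Z :=
  fun y z => ⨅ x, vhom (r x y) (t x z)

/-- The covariant action `Pf` of the `V`-powerset functor. -/
def vimage {X Y : Type u} (f : X → Y) (φ : X → V) : Y → V :=
  fun y => ⨆ x, ⨆ _ : f x = y, φ x

theorem VRel.le_ext {X Y Z : Type u} {t : VRel V X Z} {r : VRel V X Y} {s : VRel V Y Z} :
    s ≤ VRel.ext t r ↔ VRel.comp s r ≤ t := by
  constructor
  · intro h x z
    refine iSup_le fun y => ?_
    rw [mul_comm]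
    exact le_vhom.1 ((h y z).trans (iInf_le _ x))
  · intro h y z
    refine le_iInf fun x => le_vhom.2 ?_
    rw [mul_comm]
    exact (le_iSup (fun y => r x y * s y z) y).trans (h x z)

theorem VRel.comp_assoc {W X Y Z : Type u} (t : VRel V Y Z) (s : VRel V X Y) (r : VRel V W X) :
    VRel.comp t (VRel.comp s r) = VRel.comp (VRel.comp t s) r := by
  funext w z
  simp only [VRel.comp, q_mul_iSup, q_iSup_mul]
  rw [iSup_comm]
  simp only [mul_assoc]

theorem VRel.comp_mono {X Y Z : Type u} {s s' : VRel V Y Z} {r r' : VRel V X Y}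
    (hs : s ≤ s') (hr : r ≤ r') : VRel.comp s r ≤ VRel.comp s' r' := fun x z =>
  iSup_mono fun y => mul_le_mul' (hr x y) (hs y z)

theorem VRel.comp_graph {X Y Z : Type u} (s : VRel V Y Z) (f : X → Y) :
    VRel.comp s (VRel.graph V f) = fun x z => s (f x) z := by
  funext x z
  apply le_antisymm
  · refine iSup_le fun y => ?_
    simp only [VRel.graph, q_iSup_mul, one_mul]
    exact iSup_le fun h => h ▸ le_rfl
  · refine le_trans ?_ (le_iSup _ (f x))
    simp [VRel.graph]

theorem VRel.conv_graph_comp {X Y Z : Type u} (r : VRel V X Y) (f : Z → Y) :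
    VRel.comp (VRel.conv (VRel.graph V f)) r = fun x z => r x (f z) := by
  funext x z
  apply le_antisymm
  · refine iSup_le fun y => ?_
    simp only [VRel.graph, VRel.conv, q_mul_iSup, mul_one]
    exact iSup_le fun h => h ▸ le_rfl
  · refine le_trans ?_ (le_iSup _ (f z))
    simp [VRel.graph, VRel.conv]

theorem VRel.comp_conv_graph_le {X Y Z : Type u} {s : VRel V X Z} {f : X → Y} {t : VRel V Y Z} :
    VRel.comp s (VRel.conv (VRel.graph V f)) ≤ t ↔ ∀ x z, s x z ≤ t (f x) z := by
  constructor
  · intro h x z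
    refine le_trans ?_ (h (f x) z)
    refine le_trans ?_ (le_iSup _ x)
    simp [VRel.graph, VRel.conv]
  · intro h y z
    refine iSup_le fun x => ?_
    simp only [VRel.graph, VRel.conv, q_iSup_mul, one_mul]
    exact iSup_le fun e => e ▸ h x z

end VRelations

/-! ### Topological theories -/

/-- A strict topological theory: a `Set`-monad `T`, a commutative quantale `V` and a `T`-algebra
structure `ξ` on `V`. -/
structure TopologicalTheory (V : Type u) [CommMonoid V] [CompleteLattice V] [IsQuantale V] where
  /-- the monad on sets -/
  T : CategoryTheory.Monad (Type u)
  /-- `T` sends pullbacks to weak pullbacks -/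
  map_weakPullback : ∀ {X Y Z : Type u} (f : X → Z) (g : Y → Z) (𝔵 : T.obj X) (𝔶 : T.obj Y),
    T.map (↾f) 𝔵 = T.map (↾g) 𝔶 →
      ∃ 𝔴 : T.obj {p : X × Y // f p.1 = g p.2},
        T.map (↾fun p : {p : X × Y // f p.1 = g p.2} => p.1.1) 𝔴 = 𝔵 ∧
        T.map (↾fun p : {p : X × Y // f p.1 = g p.2} => p.1.2) 𝔴 = 𝔶
  /-- the naturality squares of the multiplication are weak pullbacks -/
  mul_weakPullback : ∀ {X Y : Type u} (f : X → Y) (𝔵 : T.obj X) (𝔜 : T.obj (T.obj Y)),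
    T.map (↾f) 𝔵 = T.μ.app Y 𝔜 →
      ∃ 𝔛 : T.obj (T.obj X), T.μ.app X 𝔛 = 𝔵 ∧ T.map (T.map (↾f)) 𝔛 = 𝔜
  /-- the algebra structure on the quantale -/
  ξ : T.obj V → V
  ξ_unit : ∀ v : V, ξ (T.η.app V v) = v
  ξ_mul : ∀ 𝔳 : T.obj (T.obj V), ξ (T.μ.app V 𝔳) = ξ (T.map (↾ξ) 𝔳)
  /-- the neutral element is a homomorphism of algebras -/
  ξ_one : ∀ 𝔲 : T.obj PUnit.{u + 1}, ξ (T.map (↾fun _ : PUnit.{u + 1} => (1 : V)) 𝔲) = 1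
  /-- the tensor is a homomorphism of algebras -/
  ξ_tensor : ∀ 𝔴 : T.obj (V × V),
    ξ (T.map (↾fun p : V × V => p.1 * p.2) 𝔴) =
      ξ (T.map (↾fun p : V × V => p.1) 𝔴) * ξ (T.map (↾fun p : V × V => p.2) 𝔴)
  /-- each `ξ_X : V^X → V^(TX)` is monotone -/
  ξ_mono : ∀ {X : Type u} (φ ψ : X → V), φ ≤ ψ →
    ∀ 𝔵 : T.obj X, ξ (T.map (↾φ) 𝔵) ≤ ξ (T.map (↾ψ) 𝔵)
  /-- the family `ξ_X` is natural, as a transformation from `P` to `P T` -/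
  ξ_natural : ∀ {X Y : Type u} (f : X → Y) (φ : X → V) (𝔶 : T.obj Y),
    ξ (T.map (↾(vimage f φ)) 𝔶) = vimage (T.map (↾f)) (fun 𝔵 => ξ (T.map (↾φ) 𝔵)) 𝔶

namespace TopologicalTheory

variable {V : Type u} [CommMonoid V] [CompleteLattice V] [IsQuantale V]
variable (𝕋 : TopologicalTheory V)

/-- `T` on sets. -/
abbrev obj (X : Type u) : Type u := 𝕋.T.obj X

/-- `T` on maps. -/
def map {X Y : Type u} (f : X → Y) : 𝕋.obj X → 𝕋.obj Y := fun 𝔵 => 𝕋.T.map (↾f) 𝔵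

/-- The unit `e` of the monad. -/
def e (X : Type u) : X → 𝕋.obj X := fun x => 𝕋.T.η.app X x

/-- The multiplication `m` of the monad. -/
def m (X : Type u) : 𝕋.obj (𝕋.obj X) → 𝕋.obj X := fun 𝔛 => 𝕋.T.μ.app X 𝔛

/-- `ξ_X(φ) = ξ · Tφ`. -/
def xi {X : Type u} (φ : X → V) : 𝕋.obj X → V := fun 𝔵 => 𝕋.ξ (𝕋.map φ 𝔵)

/-- `𝕋`-relations from `X` to `Y` are `V`-relations from `TX` to `Y`. -/
abbrev Rel (X Y : Type u) : Type u := VRel V (𝕋.obj X) Y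

/-- The extension of `T` to `V`-relations. -/
def Txi {X Y : Type u} (r : VRel V X Y) : VRel V (𝕋.obj X) (𝕋.obj Y) := fun 𝔵 𝔶 =>
  ⨆ 𝔴 : 𝕋.obj (X × Y), ⨆ _ : 𝕋.map Prod.fst 𝔴 = 𝔵 ∧ 𝕋.map Prod.snd 𝔴 = 𝔶,
    𝕋.xi (fun p : X × Y => r p.1 p.2) 𝔴

/-- The `𝕋`-relation `e_X°`. -/
def unitRel (X : Type u) : 𝕋.Rel X X := VRel.conv (VRel.graph V (𝕋.e X))

/-- Kleisli convolution `β ∘ α = β · T_ξ α · m_X°`. -/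
def kleisli {X Y Z : Type u} (β : 𝕋.Rel Y Z) (α : 𝕋.Rel X Y) : 𝕋.Rel X Z :=
  VRel.comp β (VRel.comp (𝕋.Txi α) (VRel.conv (VRel.graph V (𝕋.m X))))

/-- The extension of `γ` along `α` with respect to Kleisli convolution. -/
def extension {X Y Z : Type u} (γ : 𝕋.Rel X Z) (α : 𝕋.Rel X Y) : 𝕋.Rel Y Z :=
  VRel.ext γ (VRel.comp (𝕋.Txi α) (VRel.conv (VRel.graph V (𝕋.m X))))

/-! Basic calculus of `T`, `T_ξ` and Kleisli convolution. -/

theorem map_id' {X : Type u} (𝔵 : 𝕋.obj X) : 𝕋.map (fun x : X => x) 𝔵 = 𝔵 := by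
  have := 𝕋.T.map_id X
  exact congrArg (fun f : 𝕋.obj X ⟶ 𝕋.obj X => f 𝔵) this

theorem map_map {X Y Z : Type u} (g : Y → Z) (f : X → Y) (𝔵 : 𝕋.obj X) :
    𝕋.map g (𝕋.map f 𝔵) = 𝕋.map (fun x => g (f x)) 𝔵 := by
  have := 𝕋.T.map_comp (↾f) (↾g)
  exact (congrArg (fun f : 𝕋.obj X ⟶ 𝕋.obj Z => f 𝔵) this).symm

theorem map_e {X Y : Type u} (f : X → Y) (x : X) : 𝕋.map f (𝕋.e X x) = 𝕋.e Y (f x) := by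
  have := 𝕋.T.η.naturality (↾f)
  exact (congrArg (fun f : X ⟶ 𝕋.obj Y => f x) this).symm

theorem map_m {X Y : Type u} (f : X → Y) (𝔛 : 𝕋.obj (𝕋.obj X)) :
    𝕋.map f (𝕋.m X 𝔛) = 𝕋.m Y (𝕋.map (𝕋.map f) 𝔛) := by
  have := 𝕋.T.μ.naturality (↾f)
  exact (congrArg (fun f : 𝕋.obj (𝕋.obj X) ⟶ 𝕋.obj Y => f 𝔛) this).symm

theorem m_m {X : Type u} (𝔛 : 𝕋.obj (𝕋.obj (𝕋.obj X))) :
    𝕋.m X (𝕋.map (𝕋.m X) 𝔛) = 𝕋.m X (𝕋.m _ 𝔛) := by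
  have := 𝕋.T.assoc X
  exact congrArg (fun f : 𝕋.obj (𝕋.obj (𝕋.obj X)) ⟶ 𝕋.obj X => f 𝔛) this

theorem m_e {X : Type u} (𝔵 : 𝕋.obj X) : 𝕋.m X (𝕋.e _ 𝔵) = 𝔵 := by
  have := 𝕋.T.left_unit X
  exact congrArg (fun f : 𝕋.obj X ⟶ 𝕋.obj X => f 𝔵) this

theorem m_map_e {X : Type u} (𝔵 : 𝕋.obj X) : 𝕋.m X (𝕋.map (𝕋.e X) 𝔵) = 𝔵 := by
  have := 𝕋.T.right_unit X
  exact congrArg (fun f : 𝕋.obj X ⟶ 𝕋.obj X => f 𝔵) this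

theorem xi_map {X Y : Type u} (φ : Y → V) (f : X → Y) (𝔵 : 𝕋.obj X) :
    𝕋.xi φ (𝕋.map f 𝔵) = 𝕋.xi (fun x => φ (f x)) 𝔵 := by
  simp only [xi, map_map]

theorem xi_mono {X : Type u} {φ ψ : X → V} (h : ∀ x, φ x ≤ ψ x) (𝔵 : 𝕋.obj X) :
    𝕋.xi φ 𝔵 ≤ 𝕋.xi ψ 𝔵 := 𝕋.ξ_mono φ ψ h 𝔵

theorem xi_natural {X Y : Type u} (f : X → Y) (φ : X → V) (𝔶 : 𝕋.obj Y) :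
    𝕋.xi (vimage f φ) 𝔶 = ⨆ 𝔵, ⨆ _ : 𝕋.map f 𝔵 = 𝔶, 𝕋.xi φ 𝔵 := 𝕋.ξ_natural f φ 𝔶

theorem xi_one {X : Type u} (𝔵 : 𝕋.obj X) : 𝕋.xi (fun _ : X => (1 : V)) 𝔵 = 1 := by
  have h := 𝕋.ξ_one (𝕋.map (fun _ => PUnit.unit) 𝔵)
  have h2 := 𝕋.xi_map (fun _ : PUnit.{u + 1} => (1 : V)) (fun _ : X => PUnit.unit) 𝔵
  exact h2.symm.trans h

theorem xi_mul {X : Type u} (φ ψ : X → V) (𝔵 : 𝕋.obj X) :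
    𝕋.xi (fun x => φ x * ψ x) 𝔵 = 𝕋.xi φ 𝔵 * 𝕋.xi ψ 𝔵 := by
  have h := 𝕋.ξ_tensor (𝕋.map (fun x => (φ x, ψ x)) 𝔵)
  have h1 := 𝕋.xi_map (fun p : V × V => p.1 * p.2) (fun x => (φ x, ψ x)) 𝔵
  have h2 := 𝕋.xi_map (fun p : V × V => p.1) (fun x => (φ x, ψ x)) 𝔵
  have h3 := 𝕋.xi_map (fun p : V × V => p.2) (fun x => (φ x, ψ x)) 𝔵
  rw [← h1]
  exact h.trans (congrArg₂ (· * ·) h2 h3)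

theorem xi_e {X : Type u} (φ : X → V) (x : X) : 𝕋.xi φ (𝕋.e X x) = φ x := by
  simp only [xi, map_e]
  exact 𝕋.ξ_unit _

theorem xi_m {X : Type u} (φ : X → V) (𝔛 : 𝕋.obj (𝕋.obj X)) :
    𝕋.xi φ (𝕋.m X 𝔛) = 𝕋.xi (𝕋.xi φ) 𝔛 := by
  have h := 𝕋.ξ_mul (𝕋.map (𝕋.map φ) 𝔛)
  have h2 := 𝕋.map_map 𝕋.ξ (𝕋.map φ) 𝔛
  simp only [xi, map_m]
  exact h.trans (congrArg 𝕋.ξ h2)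

/-- Weak pullbacks, for an arbitrary vertex `W` over which compatible pairs are realised. -/
theorem exists_lift {X Y Z W : Type u} (f : X → Z) (g : Y → Z) (p : W → X) (q : W → Y)
    (h : ∀ x y, f x = g y → ∃ w, p w = x ∧ q w = y) (𝔵 : 𝕋.obj X) (𝔶 : 𝕋.obj Y)
    (hxy : 𝕋.map f 𝔵 = 𝕋.map g 𝔶) : ∃ 𝔴 : 𝕋.obj W, 𝕋.map p 𝔴 = 𝔵 ∧ 𝕋.map q 𝔴 = 𝔶 := by
  obtain ⟨𝔭, h1, h2⟩ := 𝕋.map_weakPullback f g 𝔵 𝔶 hxy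
  choose c hc1 hc2 using h
  refine ⟨𝕋.map (fun s : {s : X × Y // f s.1 = g s.2} => c s.1.1 s.1.2 s.2) 𝔭, ?_, ?_⟩
  · rw [map_map]
    simp only [hc1]
    exact h1
  · rw [map_map]
    simp only [hc2]
    exact h2

theorem xi_le_Txi {X Y : Type u} (r : VRel V X Y) (𝔴 : 𝕋.obj (X × Y)) :
    𝕋.xi (fun p : X × Y => r p.1 p.2) 𝔴 ≤ 𝕋.Txi r (𝕋.map Prod.fst 𝔴) (𝕋.map Prod.snd 𝔴) :=
  le_iSup₂_of_le 𝔴 ⟨rfl, rfl⟩ le_rfl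

theorem xi_le_Txi' {W X Y : Type u} (r : VRel V X Y) (f : W → X) (g : W → Y) (𝔴 : 𝕋.obj W) :
    𝕋.xi (fun w => r (f w) (g w)) 𝔴 ≤ 𝕋.Txi r (𝕋.map f 𝔴) (𝕋.map g 𝔴) := by
  have h := 𝕋.xi_le_Txi r (𝕋.map (fun w => (f w, g w)) 𝔴)
  simpa only [xi_map, map_map] using h

theorem Txi_le {X Y : Type u} {r : VRel V X Y} {s : VRel V (𝕋.obj X) (𝕋.obj Y)} :
    𝕋.Txi r ≤ s ↔ ∀ 𝔴 : 𝕋.obj (X × Y),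
      𝕋.xi (fun p : X × Y => r p.1 p.2) 𝔴 ≤ s (𝕋.map Prod.fst 𝔴) (𝕋.map Prod.snd 𝔴) := by
  constructor
  · intro h 𝔴
    exact (𝕋.xi_le_Txi r 𝔴).trans (h _ _)
  · rintro h 𝔵 𝔶
    refine iSup₂_le ?_
    rintro 𝔴 ⟨rfl, rfl⟩
    exact h 𝔴

theorem Txi_mono {X Y : Type u} {r s : VRel V X Y} (h : r ≤ s) : 𝕋.Txi r ≤ 𝕋.Txi s :=
  𝕋.Txi_le.2 fun 𝔴 => (𝕋.xi_mono (fun p => h p.1 p.2) 𝔴).trans (𝕋.xi_le_Txi s 𝔴)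

theorem Txi_le_map {X Y X' Y' : Type u} {r : VRel V X Y} {s : VRel V X' Y'} (f : X → X')
    (g : Y → Y') (h : ∀ x y, r x y ≤ s (f x) (g y)) (𝔵 : 𝕋.obj X) (𝔶 : 𝕋.obj Y) :
    𝕋.Txi r 𝔵 𝔶 ≤ 𝕋.Txi s (𝕋.map f 𝔵) (𝕋.map g 𝔶) := by
  have : 𝕋.Txi r ≤ fun 𝔵 𝔶 => 𝕋.Txi s (𝕋.map f 𝔵) (𝕋.map g 𝔶) := by
    refine 𝕋.Txi_le.2 fun 𝔴 => (𝕋.xi_mono (fun p => h p.1 p.2) 𝔴).trans ?_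
    have h := 𝕋.xi_le_Txi' s (fun p : X × Y => f p.1) (fun p => g p.2) 𝔴
    simpa only [map_map] using h
  exact this 𝔵 𝔶

theorem Txi_comp {X Y Z : Type u} (s : VRel V Y Z) (r : VRel V X Y) :
    𝕋.Txi (VRel.comp s r) = VRel.comp (𝕋.Txi s) (𝕋.Txi r) := by
  apply le_antisymm
  · refine 𝕋.Txi_le.2 fun 𝔴 => ?_
    have h1 : (fun p : X × Z => VRel.comp s r p.1 p.2) =
        vimage (fun t : X × Y × Z => (t.1, t.2.2)) (fun t => r t.1 t.2.1 * s t.2.1 t.2.2) := by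
      funext p
      apply le_antisymm
      · exact iSup_le fun y => le_iSup₂_of_le (p.1, y, p.2) rfl le_rfl
      · refine iSup₂_le ?_
        rintro t rfl
        exact le_iSup (fun y => r t.1 y * s y t.2.2) t.2.1
    rw [h1, xi_natural]
    refine iSup₂_le ?_
    rintro 𝔱 rfl
    simp only [map_map]
    rw [𝕋.xi_mul (fun t : X × Y × Z => r t.1 t.2.1) (fun t => s t.2.1 t.2.2)]
    refine le_iSup_of_le (𝕋.map (fun t : X × Y × Z => t.2.1) 𝔱) ?_
    exact mul_le_mul' (𝕋.xi_le_Txi' r _ _ 𝔱) (𝕋.xi_le_Txi' s _ _ 𝔱)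
  · intro 𝔵 𝔷
    refine iSup_le fun 𝔶 => ?_
    unfold Txi
    simp only [q_iSup_mul, q_mul_iSup]
    refine iSup₂_le ?_
    rintro 𝔴 ⟨h3, rfl⟩
    refine iSup₂_le ?_
    rintro 𝔳 ⟨rfl, h2⟩
    obtain ⟨𝔱, rfl, rfl⟩ := 𝕋.exists_lift (W := X × Y × Z) (Prod.snd : X × Y → Y)
      (Prod.fst : Y × Z → Y) (fun t => (t.1, t.2.1)) (fun t => t.2)
      (by rintro ⟨x, y⟩ ⟨y', z⟩ (rfl : y = y'); exact ⟨(x, y, z), rfl, rfl⟩) 𝔳 𝔴 (h2.trans h3.symm)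
    simp only [map_map, xi_map]
    rw [← xi_mul]
    refine le_trans (𝕋.xi_mono (fun t => ?_) 𝔱)
      (𝕋.xi_le_Txi' (VRel.comp s r) (fun t : X × Y × Z => t.1) (fun t => t.2.2) 𝔱)
    exact le_iSup (fun y => r t.1 y * s y t.2.2) t.2.1

theorem Txi_conv_graph {X Y : Type u} (f : X → Y) :
    𝕋.Txi (VRel.conv (VRel.graph V f)) = VRel.conv (VRel.graph V (𝕋.map f)) := by
  apply le_antisymm
  · refine 𝕋.Txi_le.2 fun 𝔴 => ?_
    have h1 : (fun p : Y × X => VRel.conv (VRel.graph V f) p.1 p.2) =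
        vimage (fun x : X => (f x, x)) (fun _ => (1 : V)) := by
      funext p
      apply le_antisymm
      · exact iSup_le fun h => le_iSup₂_of_le p.2 (Prod.ext h rfl) le_rfl
      · refine iSup₂_le ?_
        rintro x rfl
        simp [VRel.conv, VRel.graph]
    rw [h1, xi_natural]
    refine iSup₂_le ?_
    rintro 𝔵 rfl
    simp only [map_map, xi_one, map_id']
    simp [VRel.conv, VRel.graph]
  · intro 𝔶 𝔵
    refine iSup_le ?_
    intro h
    subst h
    refine le_trans ?_ (𝕋.xi_le_Txi' (VRel.conv (VRel.graph V f)) f (fun x => x) 𝔵) |>.trans_eq ?_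
    · rw [← 𝕋.xi_one 𝔵]
      exact 𝕋.xi_mono (fun x => by simp [VRel.conv, VRel.graph]) 𝔵
    · rw [map_id']

theorem Txi_m {X Y : Type u} (r : VRel V X Y) :
    VRel.comp (𝕋.Txi (𝕋.Txi r)) (VRel.conv (VRel.graph V (𝕋.m X))) =
      VRel.comp (VRel.conv (VRel.graph V (𝕋.m Y))) (𝕋.Txi r) := by
  rw [VRel.conv_graph_comp]
  apply le_antisymm
  · refine VRel.comp_conv_graph_le.2 ?_
    suffices h : 𝕋.Txi (𝕋.Txi r) ≤ fun 𝔛 𝔜 => 𝕋.Txi r (𝕋.m X 𝔛) (𝕋.m Y 𝔜) from fun a b => h a b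
    refine 𝕋.Txi_le.2 fun 𝔴 => ?_
    have h1 : (fun p : 𝕋.obj X × 𝕋.obj Y => 𝕋.Txi r p.1 p.2) =
        vimage (fun 𝔳 : 𝕋.obj (X × Y) => (𝕋.map Prod.fst 𝔳, 𝕋.map Prod.snd 𝔳))
          (𝕋.xi (fun p : X × Y => r p.1 p.2)) := by
      funext p
      simp only [Txi, vimage, Prod.ext_iff]
    rw [h1, xi_natural]
    refine iSup₂_le ?_
    rintro 𝔙 rfl
    rw [← xi_m]
    refine (𝕋.xi_le_Txi r _).trans_eq ?_
    simp only [map_map, map_m]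
  · intro 𝔵 𝔜
    refine iSup₂_le ?_
    rintro 𝔴 ⟨rfl, h2⟩
    obtain ⟨𝔚, rfl, rfl⟩ := 𝕋.mul_weakPullback (Prod.snd : X × Y → Y) 𝔴 𝔜 h2
    have h3 := VRel.comp_conv_graph_le.1 (le_refl
      (VRel.comp (𝕋.Txi (𝕋.Txi r)) (VRel.conv (VRel.graph V (𝕋.m X)))))
      (𝕋.map (𝕋.map Prod.fst) 𝔚) (𝕋.map (𝕋.map Prod.snd) 𝔚)
    rw [← map_m] at h3
    refine le_trans ?_ h3
    change 𝕋.xi _ (𝕋.m _ 𝔚) ≤ _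
    rw [xi_m]
    exact (𝕋.xi_mono (fun 𝔳 => 𝕋.xi_le_Txi r 𝔳) 𝔚).trans
      (𝕋.xi_le_Txi' (𝕋.Txi r) (𝕋.map Prod.fst) (𝕋.map Prod.snd) 𝔚)

theorem kleisli_mono {X Y Z : Type u} {β β' : 𝕋.Rel Y Z} {α α' : 𝕋.Rel X Y}
    (hβ : β ≤ β') (hα : α ≤ α') : 𝕋.kleisli β α ≤ 𝕋.kleisli β' α' :=
  VRel.comp_mono hβ (VRel.comp_mono (𝕋.Txi_mono hα) le_rfl)

theorem kleisli_le {X Y Z : Type u} {β : 𝕋.Rel Y Z} {α : 𝕋.Rel X Y} {γ : 𝕋.Rel X Z} :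
    𝕋.kleisli β α ≤ γ ↔ ∀ 𝔛 𝔶 z, 𝕋.Txi α 𝔛 𝔶 * β 𝔶 z ≤ γ (𝕋.m X 𝔛) z := by
  rw [kleisli, VRel.comp_assoc, VRel.comp_conv_graph_le]
  simp only [VRel.comp, iSup_le_iff]
  exact forall_congr' fun _ => forall_comm

theorem le_kleisli {X Y Z : Type u} (β : 𝕋.Rel Y Z) (α : 𝕋.Rel X Y)
    (𝔛 : 𝕋.obj (𝕋.obj X)) (𝔶 : 𝕋.obj Y) (z : Z) :
    𝕋.Txi α 𝔛 𝔶 * β 𝔶 z ≤ 𝕋.kleisli β α (𝕋.m X 𝔛) z :=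
  𝕋.kleisli_le.1 le_rfl 𝔛 𝔶 z

theorem kleisli_assoc {W X Y Z : Type u} (γ : 𝕋.Rel Y Z) (β : 𝕋.Rel X Y) (α : 𝕋.Rel W X) :
    𝕋.kleisli γ (𝕋.kleisli β α) = 𝕋.kleisli (𝕋.kleisli γ β) α := by
  have hm : VRel.comp (VRel.conv (VRel.graph V (𝕋.map (𝕋.m W)))) (VRel.conv (VRel.graph V (𝕋.m W)))
      = VRel.comp (VRel.conv (VRel.graph V (𝕋.m (𝕋.obj W)))) (VRel.conv (VRel.graph V (𝕋.m W))) := by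
    rw [VRel.conv_graph_comp, VRel.conv_graph_comp]
    funext 𝔴 𝔚
    simp only [VRel.conv, VRel.graph, m_m]
  unfold kleisli
  rw [Txi_comp, Txi_comp, Txi_conv_graph]
  simp only [← VRel.comp_assoc]
  rw [hm]
  congr 2
  rw [VRel.comp_assoc, VRel.comp_assoc, Txi_m]

theorem le_extension {X Y Z : Type u} {γ : 𝕋.Rel X Z} {α : 𝕋.Rel X Y} {β : 𝕋.Rel Y Z} :
    β ≤ 𝕋.extension γ α ↔ 𝕋.kleisli β α ≤ γ := VRel.le_ext

theorem le_kleisli_of_unit_le {X Y : Type u} {b : 𝕋.Rel Y Y} (hb : 𝕋.unitRel Y ≤ b)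
    (φ : 𝕋.Rel X Y) : φ ≤ 𝕋.kleisli b φ := by
  intro 𝔵 y
  have h := 𝕋.le_kleisli b φ (𝕋.e _ 𝔵) (𝕋.e _ y) y
  rw [m_e] at h
  refine le_trans ?_ h
  have h1 : (1 : V) ≤ b (𝕋.e Y y) y :=
    le_trans (by simp [unitRel, VRel.conv, VRel.graph]) (hb (𝕋.e Y y) y)
  have h2 : φ 𝔵 y ≤ 𝕋.Txi φ (𝕋.e _ 𝔵) (𝕋.e _ y) := by
    have := 𝕋.xi_le_Txi φ (𝕋.e _ (𝔵, y))
    simpa only [xi_e, map_e] using this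
  simpa using mul_le_mul' h2 h1

theorem kleisli_unit {X Y : Type u} (φ : 𝕋.Rel X Y) : 𝕋.kleisli φ (𝕋.unitRel X) = φ := by
  unfold kleisli unitRel
  rw [Txi_conv_graph, VRel.conv_graph_comp]
  have : (fun (x : 𝕋.obj X) z => VRel.conv (VRel.graph V (𝕋.m X)) x (𝕋.map (𝕋.e X) z)) =
      VRel.graph V (fun 𝔵 : 𝕋.obj X => 𝔵) := by
    funext x z
    simp only [VRel.conv, VRel.graph, m_map_e, eq_comm]
  rw [this, VRel.comp_graph]

theorem Txi_unit_right {X Y : Type u} (φ : 𝕋.Rel X Y) (y : Y) (𝔛 : 𝕋.obj (𝕋.obj X)) :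
    𝕋.Txi φ 𝔛 (𝕋.e Y y) ≤
      𝕋.Txi (fun 𝔵 (_ : PUnit.{u + 1}) => φ 𝔵 y) 𝔛 (𝕋.e PUnit.{u + 1} PUnit.unit) := by
  refine iSup₂_le ?_
  rintro 𝔴 ⟨rfl, h⟩
  rw [← 𝕋.map_e (fun _ : PUnit.{u + 1} => y) PUnit.unit] at h
  obtain ⟨𝔳, rfl, h2⟩ := 𝕋.exists_lift (W := 𝕋.obj X × PUnit.{u + 1})
    (Prod.snd : 𝕋.obj X × Y → Y) (fun _ : PUnit.{u + 1} => y) (fun p => (p.1, y)) Prod.snd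
    (by rintro ⟨𝔵, y'⟩ ⟨⟩ (rfl : y' = y); exact ⟨(𝔵, PUnit.unit), rfl, rfl⟩) 𝔴 _ h
  rw [← h2, xi_map, map_map]
  exact 𝕋.xi_le_Txi' (fun 𝔵 (_ : PUnit.{u + 1}) => φ 𝔵 y) Prod.fst Prod.snd 𝔳

end TopologicalTheory

/-! ### `𝕋`-categories and `𝕋`-functors -/

section TCategories

variable {V : Type u} [CommMonoid V] [CompleteLattice V] [IsQuantale V]

/-- A `𝕋`-category `(X, a)`. -/
structure TCat (𝕋 : TopologicalTheory V) where
  carrier : Type u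
  str : 𝕋.Rel carrier carrier
  unit_le : 𝕋.unitRel carrier ≤ str
  comp_le : 𝕋.kleisli str str ≤ str

/-- A `𝕋`-functor `(X, a) ⟶ (Y, b)`. -/
@[ext]
structure TFunctor {𝕋 : TopologicalTheory V} (X Y : TCat 𝕋) where
  toFun : X.carrier → Y.carrier
  str_le : ∀ (𝔵 : 𝕋.obj X.carrier) (x : X.carrier),
    X.str 𝔵 x ≤ Y.str (𝕋.map toFun 𝔵) (toFun x)

variable {𝕋 : TopologicalTheory V}

instance : Category (TCat 𝕋) where
  Hom X Y := TFunctor X Y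
  id X := ⟨fun x => x, fun 𝔵 x => by rw [𝕋.map_id']⟩
  comp f g := ⟨fun x => g.toFun (f.toFun x), fun 𝔵 x => by
    rw [← 𝕋.map_map g.toFun f.toFun]
    exact (f.str_le 𝔵 x).trans (g.str_le _ _)⟩

/-- The one-point `𝕋`-category `G = (1, e_1°)`. -/
def TCat.G (𝕋 : TopologicalTheory V) : TCat 𝕋 where
  carrier := PUnit.{u + 1}
  str := 𝕋.unitRel PUnit.{u + 1}
  unit_le := le_rfl
  comp_le := (𝕋.kleisli_unit _).le

/-- The `𝕋`-relation `φ : X ⇸ Y` is a `𝕋`-distributor: `φ ∘ a ≤ φ` and `b ∘ φ ≤ φ`. -/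
def IsDistributor (X Y : TCat 𝕋) (φ : 𝕋.Rel X.carrier Y.carrier) : Prop :=
  𝕋.kleisli φ X.str ≤ φ ∧ 𝕋.kleisli Y.str φ ≤ φ

/-- `f_* = b · Tf`. -/
def lowerStar {X Y : TCat 𝕋} (f : X ⟶ Y) : 𝕋.Rel X.carrier Y.carrier :=
  VRel.comp Y.str (VRel.graph V (𝕋.map f.toFun))

/-- `f^* = f° · b`. -/
def upperStar {X Y : TCat 𝕋} (f : X ⟶ Y) : 𝕋.Rel Y.carrier X.carrier :=
  VRel.comp (VRel.conv (VRel.graph V f.toFun)) Y.str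

/-- The order on `𝕋`-functors: `f ≤ g` iff `f^* ≤ g^*`. -/
def TLe {X Y : TCat 𝕋} (f g : X ⟶ Y) : Prop := upperStar f ≤ upperStar g

/-- `f` is left adjoint to `g`: `1 ≤ g · f` and `f · g ≤ 1`. -/
def IsTAdjoint {X Y : TCat 𝕋} (f : X ⟶ Y) (g : Y ⟶ X) : Prop :=
  TLe (𝟙 X) (f ≫ g) ∧ TLe (g ≫ f) (𝟙 Y)

/-- Equivalent `𝕋`-functors into a separated `𝕋`-category are equal. -/
def IsSeparated (X : TCat 𝕋) : Prop :=
  ∀ (Y : TCat 𝕋) (f g : Y ⟶ X), TLe f g → TLe g f → f = g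

/-- `g : Z ⟶ X` is a colimit of `h : Y ⟶ X` weighted by `φ : Y ⇸ Z`: `g_*` is the extension of
`h_*` along `φ`. -/
def IsWeightedColimit {X Y Z : TCat 𝕋} (φ : 𝕋.Rel Y.carrier Z.carrier) (h : Y ⟶ X)
    (g : Z ⟶ X) : Prop :=
  lowerStar g = 𝕋.extension (lowerStar h) φ

/-- The point `y : G ⟶ Y`. -/
def TCat.point (Y : TCat 𝕋) (y : Y.carrier) : TCat.G 𝕋 ⟶ Y where
  toFun _ := y
  str_le 𝔵 x := by
    refine iSup_le ?_
    rintro rfl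
    have h : (1 : V) ≤ Y.str (𝕋.e _ y) y :=
      le_trans (by simp [TopologicalTheory.unitRel, VRel.conv, VRel.graph])
        (Y.unit_le (𝕋.e _ y) y)
    rw [← 𝕋.map_e (fun _ : PUnit.{u + 1} => y) PUnit.unit] at h
    exact h

/-- A `𝕋`-category restricted to a subset. -/
def TCat.sub (X : TCat 𝕋) (p : X.carrier → Prop) : TCat 𝕋 where
  carrier := {x : X.carrier // p x}
  str := fun 𝔵 x => X.str (𝕋.map Subtype.val 𝔵) x.1
  unit_le := by
    intro 𝔵 x
    refine iSup_le ?_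
    rintro rfl
    have h : (1 : V) ≤ X.str (𝕋.e _ x.1) x.1 :=
      le_trans (by simp [TopologicalTheory.unitRel, VRel.conv, VRel.graph])
        (X.unit_le (𝕋.e _ x.1) x.1)
    rw [← 𝕋.map_e (Subtype.val : {x : X.carrier // p x} → X.carrier) x] at h
    exact h
  comp_le := by
    refine 𝕋.kleisli_le.2 fun 𝔛 𝔶 z => ?_
    rw [𝕋.map_m]
    refine le_trans ?_ (𝕋.kleisli_le.1 X.comp_le _ (𝕋.map Subtype.val 𝔶) z.1)
    exact mul_le_mul' (𝕋.Txi_le_map (s := X.str) (𝕋.map Subtype.val) Subtype.val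
      (fun _ _ => le_rfl) 𝔛 𝔶) le_rfl

/-- The underlying set of the `𝕋`-category of presheaves on `X`: all distributors `X ⇸ G`. -/
def PshCarrier (X : TCat 𝕋) : Type u :=
  {ψ : 𝕋.Rel X.carrier PUnit.{u + 1} // IsDistributor X (TCat.G 𝕋) ψ}

/-- Evaluation, as a `𝕋`-relation from `X` to presheaves on `X`. -/
def pshEv (X : TCat 𝕋) : 𝕋.Rel X.carrier (PshCarrier X) := fun 𝔵 ψ => ψ.1 𝔵 PUnit.unit

/-- The structure of `V^|X|`, restricted to presheaves. Since `T` sends pullbacks to weak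
pullbacks, it does not matter whether `𝔮` ranges over `T(TX × PX)` or over `T(TX × V^|X|)`. -/
def pshStr (X : TCat 𝕋) : 𝕋.Rel (PshCarrier X) (PshCarrier X) := fun 𝔭 ψ =>
  ⨅ 𝔮 : 𝕋.obj (𝕋.obj X.carrier × PshCarrier X), ⨅ _ : 𝕋.map Prod.snd 𝔮 = 𝔭,
    vhom (𝕋.xi (fun p : 𝕋.obj X.carrier × PshCarrier X => pshEv X p.1 p.2) 𝔮)
      (pshEv X (𝕋.m X.carrier (𝕋.map Prod.fst 𝔮)) ψ)

theorem le_pshStr (X : TCat 𝕋) (r : 𝕋.Rel (PshCarrier X) (PshCarrier X)) :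
    r ≤ pshStr X ↔ 𝕋.kleisli r (pshEv X) ≤ pshEv X := by
  rw [𝕋.kleisli_le]
  constructor
  · intro h 𝔛 𝔭 ψ
    unfold TopologicalTheory.Txi
    simp only [q_iSup_mul]
    refine iSup₂_le ?_
    rintro 𝔮 ⟨rfl, rfl⟩
    rw [mul_comm]
    refine le_vhom.1 ((h _ ψ).trans ?_)
    exact iInf_le_of_le 𝔮 (iInf_le_of_le rfl le_rfl)
  · intro h 𝔭 ψ
    refine le_iInf₂ ?_
    rintro 𝔮 rfl
    refine le_vhom.2 (le_trans ?_ (h (𝕋.map Prod.fst 𝔮) (𝕋.map Prod.snd 𝔮) ψ))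
    rw [mul_comm]
    exact mul_le_mul' (𝕋.xi_le_Txi (pshEv X) 𝔮) le_rfl

/-- The `𝕋`-category `PX` of contravariant presheaves on `X`. -/
def TCat.psh (X : TCat 𝕋) : TCat 𝕋 where
  carrier := PshCarrier X
  str := pshStr X
  unit_le := by
    rw [le_pshStr, 𝕋.kleisli_le]
    intro 𝔛 𝔭 ψ
    simp only [TopologicalTheory.unitRel, VRel.conv, VRel.graph, q_mul_iSup, mul_one]
    refine iSup_le ?_
    rintro rfl
    refine (𝕋.Txi_unit_right (pshEv X) ψ 𝔛).trans ?_
    have h := 𝕋.kleisli_le.1 ψ.2.2 𝔛 (𝕋.e PUnit.{u + 1} PUnit.unit) PUnit.unit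
    refine le_trans ?_ h
    refine le_trans (mul_one _).ge (mul_le_mul' le_rfl ?_)
    simp [TCat.G, TopologicalTheory.unitRel, VRel.conv, VRel.graph]
  comp_le := by
    have h1 := (le_pshStr X (pshStr X)).1 le_rfl
    rw [le_pshStr, ← 𝕋.kleisli_assoc]
    exact (𝕋.kleisli_mono le_rfl h1).trans h1

end TCategories

/-! ### Classes of distributors -/

section DistributorClasses

variable {V : Type u} [CommMonoid V] [CompleteLattice V] [IsQuantale V]

/-- A class `Φ` of `𝕋`-distributors satisfying the three closure axioms. -/
structure DistributorClass (𝕋 : TopologicalTheory V) where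
  mem : ∀ X Y : TCat 𝕋, 𝕋.Rel X.carrier Y.carrier → Prop
  isDistributor : ∀ {X Y : TCat 𝕋} {φ : 𝕋.Rel X.carrier Y.carrier},
    mem X Y φ → IsDistributor X Y φ
  ax1 : ∀ {X Y : TCat 𝕋} (f : X ⟶ Y), mem Y X (upperStar f)
  ax2_upper_comp : ∀ {X Y A : TCat 𝕋} {φ : 𝕋.Rel Y.carrier X.carrier} (f : A ⟶ X),
    mem Y X φ → mem Y A (𝕋.kleisli (upperStar f) φ)
  ax2_comp_upper : ∀ {X Y A : TCat 𝕋} {φ : 𝕋.Rel A.carrier Y.carrier} (f : A ⟶ X),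
    mem A Y φ → mem X Y (𝕋.kleisli φ (upperStar f))
  ax2_comp_lower : ∀ {X Y A : TCat 𝕋} {φ : 𝕋.Rel X.carrier Y.carrier} (f : A ⟶ X),
    mem X Y φ → mem A X (lowerStar f) → mem A Y (𝕋.kleisli φ (lowerStar f))
  ax3 : ∀ {X Y : TCat 𝕋} {φ : 𝕋.Rel X.carrier Y.carrier}, IsDistributor X Y φ →
    (∀ y : Y.carrier, mem X (TCat.G 𝕋) (𝕋.kleisli (upperStar (Y.point y)) φ)) → mem X Y φ

variable {𝕋 : TopologicalTheory V} (Φ : DistributorClass 𝕋)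

namespace DistributorClass

/-- `X` is `Φ`-cocomplete: all colimits weighted by members of `Φ` exist in `X`. -/
def IsCocomplete (X : TCat 𝕋) : Prop :=
  ∀ (Y Z : TCat 𝕋) (φ : 𝕋.Rel Y.carrier Z.carrier) (h : Y ⟶ X), Φ.mem Y Z φ →
    ∃ g : Z ⟶ X, IsWeightedColimit φ h g

/-- `f` is `Φ`-cocontinuous: it preserves all existing colimits weighted by members of `Φ`. -/
def IsCocontinuous {X X' : TCat 𝕋} (f : X ⟶ X') : Prop :=
  ∀ (Y Z : TCat 𝕋) (φ : 𝕋.Rel Y.carrier Z.carrier) (h : Y ⟶ X) (g : Z ⟶ X), Φ.mem Y Z φ →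
    IsWeightedColimit φ h g → IsWeightedColimit φ (h ≫ f) (g ≫ f)

/-- A separated `Φ`-cocomplete `𝕋`-category. -/
structure CocomplSep where
  toTCat : TCat 𝕋
  separated : IsSeparated toTCat
  cocomplete : Φ.IsCocomplete toTCat

/-- Separated `Φ`-cocomplete `𝕋`-categories and `Φ`-cocontinuous `𝕋`-functors. -/
instance : Category Φ.CocomplSep where
  Hom X Y := {f : X.toTCat ⟶ Y.toTCat // Φ.IsCocontinuous f}
  id X := ⟨𝟙 X.toTCat, fun _ _ _ _ _ _ hg => hg⟩
  comp f g := ⟨f.1 ≫ g.1, fun Y Z φ h c hφ hc =>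
    g.2 Y Z φ (h ≫ f.1) (c ≫ f.1) hφ (f.2 Y Z φ h c hφ hc)⟩

/-- The inclusion of separated `Φ`-cocomplete `𝕋`-categories into all `𝕋`-categories. -/
def inclusion : Φ.CocomplSep ⥤ TCat 𝕋 where
  obj X := X.toTCat
  map f := f.1

/-- `ΦX`: the members of `Φ` among the presheaves on `X`, as a subcategory of `PX`. -/
def phiObj (X : TCat 𝕋) : TCat 𝕋 :=
  X.psh.sub fun ψ => Φ.mem X (TCat.G 𝕋) ψ.1

variable {Φ} in
/-- The presheaf underlying an element of `ΦX`. -/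
def val {X : TCat 𝕋} (ψ : (Φ.phiObj X).carrier) : 𝕋.Rel X.carrier PUnit.{u + 1} := ψ.1.1

variable {Φ} in
/-- Members of `Φ` from `X` to `G`, as elements of `ΦX`. -/
def elt {X : TCat 𝕋} (ψ : 𝕋.Rel X.carrier PUnit.{u + 1}) (h : Φ.mem X (TCat.G 𝕋) ψ) :
    (Φ.phiObj X).carrier :=
  ⟨⟨ψ, Φ.isDistributor h⟩, h⟩

/-- A distributor `φ : X ⇸ Y` all of whose values `φ(-, y)` lie in `Φ` induces a `𝕋`-functor
`Y ⟶ ΦX`. -/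
def mate {X Y : TCat 𝕋} (φ : 𝕋.Rel X.carrier Y.carrier) (hφ : IsDistributor X Y φ)
    (h : ∀ y, Φ.mem X (TCat.G 𝕋) fun 𝔵 _ => φ 𝔵 y) : Y ⟶ Φ.phiObj X where
  toFun y := elt (fun 𝔵 _ => φ 𝔵 y) (h y)
  str_le 𝔶 y := by
    refine le_iInf₂ ?_
    intro 𝔮 h𝔮
    have h𝔮' := h𝔮.trans (𝕋.map_map (X := Y.carrier) _ _ 𝔶)
    obtain ⟨𝔴, rfl, rfl⟩ := 𝕋.exists_lift (W := 𝕋.obj X.carrier × Y.carrier)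
      (Prod.snd : 𝕋.obj X.carrier × PshCarrier X → PshCarrier X)
      (fun y => (⟨fun 𝔵 _ => φ 𝔵 y, Φ.isDistributor (h y)⟩ : PshCarrier X))
      (fun p => (p.1, ⟨fun 𝔵 _ => φ 𝔵 p.2, Φ.isDistributor (h p.2)⟩)) Prod.snd
      (by rintro ⟨𝔵, ψ⟩ y rfl; exact ⟨(𝔵, y), rfl, rfl⟩) 𝔮 𝔶 h𝔮'
    refine le_vhom.2 ?_
    rw [𝕋.xi_map, 𝕋.map_map, mul_comm]
    refine le_trans (mul_le_mul' ?_ le_rfl)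
      (𝕋.kleisli_le.1 hφ.2 (𝕋.map Prod.fst 𝔴) (𝕋.map Prod.snd 𝔴) y)
    exact 𝕋.xi_le_Txi φ 𝔴

/-- Evaluation, as a `𝕋`-relation from `X` to `ΦX`. -/
def ev (X : TCat 𝕋) : 𝕋.Rel X.carrier (Φ.phiObj X).carrier := fun 𝔵 ψ => val ψ 𝔵 PUnit.unit

theorem str_ev (X : TCat 𝕋) : 𝕋.kleisli (Φ.phiObj X).str (Φ.ev X) ≤ Φ.ev X := by
  have h1 := (le_pshStr X (pshStr X)).1 le_rfl
  refine 𝕋.kleisli_le.2 fun 𝔛 𝔭 ψ => ?_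
  refine le_trans (mul_le_mul' ?_ le_rfl) (𝕋.kleisli_le.1 h1 𝔛 (𝕋.map Subtype.val 𝔭) ψ.1)
  have h2 := 𝕋.Txi_le_map (r := Φ.ev X) (s := pshEv X) (fun 𝔵 => 𝔵) Subtype.val
    (fun _ _ => le_rfl) 𝔛 𝔭
  rwa [𝕋.map_id'] at h2

/-- The corestricted Yoneda functor `y_X : X ⟶ ΦX`, `x ↦ a(-, x)`. -/
def yoneda (X : TCat 𝕋) : X ⟶ Φ.phiObj X :=
  Φ.mate X.str ⟨X.comp_le, X.comp_le⟩ fun x => by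
    have h := Φ.ax1 (X.point x)
    rwa [upperStar, VRel.conv_graph_comp] at h

theorem isDistributor_ev_upperStar {X Y : TCat 𝕋} (f : X ⟶ Y) :
    IsDistributor Y (Φ.phiObj X) (𝕋.kleisli (Φ.ev X) (upperStar f)) := by
  constructor
  · rw [← 𝕋.kleisli_assoc]
    exact 𝕋.kleisli_mono le_rfl (Φ.isDistributor (Φ.ax1 f)).1
  · rw [𝕋.kleisli_assoc]
    exact 𝕋.kleisli_mono (Φ.str_ev X) le_rfl

/-- The `𝕋`-functor `Φf : ΦX ⟶ ΦY`, `ψ ↦ ψ ∘ f^*`. -/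
def phiMap {X Y : TCat 𝕋} (f : X ⟶ Y) : Φ.phiObj X ⟶ Φ.phiObj Y where
  toFun ψ := elt (𝕋.kleisli (val ψ) (upperStar f)) (Φ.ax2_comp_upper f ψ.2)
  str_le := (Φ.mate (𝕋.kleisli (Φ.ev X) (upperStar f)) (Φ.isDistributor_ev_upperStar f)
    fun ψ => Φ.ax2_comp_upper f ψ.2).str_le

theorem phi_hom_ext {X Y : TCat 𝕋} {f g : Y ⟶ Φ.phiObj X}
    (h : ∀ y, val (f.toFun y) = val (g.toFun y)) : f = g :=
  TFunctor.ext (funext fun y => Subtype.ext (Subtype.ext (h y)))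

/-- The endofunctor `Φ` of the category of `𝕋`-categories. -/
def phi : TCat 𝕋 ⥤ TCat 𝕋 where
  obj X := Φ.phiObj X
  map f := Φ.phiMap f
  map_id X := by
    refine Φ.phi_hom_ext fun ψ => ?_
    have h : upperStar (𝟙 X) = X.str := by
      rw [upperStar, VRel.conv_graph_comp]; rfl
    change 𝕋.kleisli (val ψ) (upperStar (𝟙 X)) = val ψ
    rw [h]
    refine le_antisymm (Φ.isDistributor ψ.2).1 ?_
    have h2 := 𝕋.kleisli_mono (le_refl (val ψ)) X.unit_le
    rwa [𝕋.kleisli_unit] at h2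
  map_comp {X Y Z} f g := by
    refine Φ.phi_hom_ext fun ψ => ?_
    change 𝕋.kleisli (val ψ) (upperStar (f ≫ g)) =
      𝕋.kleisli (𝕋.kleisli (val ψ) (upperStar f)) (upperStar g)
    rw [← 𝕋.kleisli_assoc]
    congr 1
    have h1 : 𝕋.kleisli Y.str (upperStar g) = upperStar g :=
      le_antisymm (Φ.isDistributor (Φ.ax1 g)).2 (𝕋.le_kleisli_of_unit_le Y.unit_le _)
    have h2 : 𝕋.kleisli (upperStar f) (upperStar g) =
        VRel.comp (VRel.conv (VRel.graph V f.toFun)) (𝕋.kleisli Y.str (upperStar g)) := by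
      unfold TopologicalTheory.kleisli
      rw [VRel.comp_assoc (VRel.conv (VRel.graph V f.toFun)), ← upperStar]
    rw [h2, h1]
    simp only [upperStar, VRel.conv_graph_comp]
    rfl

/-- `Φ` with values in separated `Φ`-cocomplete `𝕋`-categories and `Φ`-cocontinuous
`𝕋`-functors. -/
def reflector (hs : ∀ X : TCat 𝕋, IsSeparated (Φ.phiObj X))
    (hc : ∀ X : TCat 𝕋, Φ.IsCocomplete (Φ.phiObj X))
    (hm : ∀ {X Y : TCat 𝕋} (f : X ⟶ Y), Φ.IsCocontinuous (Φ.phiMap f)) :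
    TCat 𝕋 ⥤ Φ.CocomplSep where
  obj X := ⟨Φ.phiObj X, hs X, hc X⟩
  map f := ⟨Φ.phiMap f, hm f⟩
  map_id X := Subtype.ext (Φ.phi.map_id X)
  map_comp f g := Subtype.ext (Φ.phi.map_comp f g)

end DistributorClass

/-- A monad on the category of `𝕋`-categories is of Kock–Zöberlein type: its functor is monotone
on hom-sets (a 2-functor), and there are adjunctions `M η_X ⊣ μ_X ⊣ η_{M X}`. -/
structure IsKockZoberlein {𝕋 : TopologicalTheory V} (M : CategoryTheory.Monad (TCat 𝕋)) :
    Prop where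
  monotone : ∀ {X Y : TCat 𝕋} (f g : X ⟶ Y), TLe f g → TLe (M.map f) (M.map g)
  map_unit_adj : ∀ X : TCat 𝕋, IsTAdjoint (M.map (M.η.app X)) (M.μ.app X)
  adj_unit_map : ∀ X : TCat 𝕋, IsTAdjoint (M.μ.app X) (M.η.app (M.obj X))

end DistributorClasses

section

variable {V : Type u} [CommMonoid V] [CompleteLattice V] [IsQuantale V]

/-! ### Units and extensions for Kleisli convolution. -/

namespace TopologicalTheory

variable (𝕋 : TopologicalTheory V)

/-! Everything reduces to an ordered calculus of distributors, in which $f_*\dashv f^*$ and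
extension along $\alpha$ is right adjoint to precomposition with $\alpha$. Let `rel h` be the
distributor $X\rightharpoonup Y$ that corresponds to $h:Y\to\Phi X$; axioms (2) and (3) say that
these are exactly the distributors in $\Phi$. By the Yoneda lemma (`lowerStar_yoneda`),
$(y_X)_*=\mathrm{ev}$, and hence $h_*=\mathrm{ev}/\mathrm{rel}\,h$ (`lowerStar_eq_extension`). Since
$\gamma/(\beta\circ\alpha)=(\gamma/\alpha)/\beta$, colimits in $\Phi X$ are mere composition:
$\mathrm{rel}\,g=\varphi\circ\mathrm{rel}\,h$. This gives cocompleteness of $\Phi X$ and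
cocontinuity of $\Phi f$.

If $F:\Phi X\to A$ is the colimit of $f$ weighted by $(y_X)_*$, then $(F\cdot
h)_*=f_*/\mathrm{rel}\,h$ for every $h$, so $F$ is cocontinuous. Conversely, the identity of $\Phi
X$ is the colimit of $y_X$ weighted by $(y_X)_*$, so a cocontinuous $F$ is determined by $F\cdot
y_X$. This is the adjunction.

For monadicity, any retraction $\alpha$ of $y_A$ is already the extension of the identity
(`isYonedaExtension_of_retraction`). It then computes all $\Phi$-weighted colimits in $A$, and
algebra homomorphisms preserve them.

Fullness fails because a constant functor need not preserve the empty colimit. -/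

theorem one_le_unitRel {X : Type u} (x : X) : (1 : V) ≤ 𝕋.unitRel X (𝕋.e X x) x := by
  simp [unitRel, VRel.conv, VRel.graph]

theorem one_le_xi {X : Type u} {φ : X → V} (h : ∀ x, 1 ≤ φ x) (𝔵 : 𝕋.obj X) :
    1 ≤ 𝕋.xi φ 𝔵 :=
  (𝕋.xi_one 𝔵).ge.trans (𝕋.xi_mono h 𝔵)

theorem le_kleisli_of_unit_le_right {X Y : Type u} {a : 𝕋.Rel X X} (ha : 𝕋.unitRel X ≤ a)
    (φ : 𝕋.Rel X Y) : φ ≤ 𝕋.kleisli φ a :=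
  (𝕋.kleisli_unit φ).ge.trans (𝕋.kleisli_mono le_rfl ha)

theorem kleisli_conv_graph_comp {X Y Z A : Type u} (f : A → Z) (b : 𝕋.Rel Y Z)
    (φ : 𝕋.Rel X Y) :
    𝕋.kleisli (VRel.comp (VRel.conv (VRel.graph V f)) b) φ =
      fun 𝔵 x => 𝕋.kleisli b φ 𝔵 (f x) := by
  unfold kleisli
  rw [← VRel.comp_assoc, VRel.conv_graph_comp]

/-- Two applications of the adjunction and associativity of convolution. This law is what turns
weighted colimits of presheaves into composites. -/
theorem extension_kleisli {X Y Z A : Type u} (γ : 𝕋.Rel X A) (β : 𝕋.Rel Y Z)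
    (α : 𝕋.Rel X Y) :
    𝕋.extension γ (𝕋.kleisli β α) = 𝕋.extension (𝕋.extension γ α) β :=
  eq_of_forall_le_iff fun δ => by
    rw [le_extension, le_extension, le_extension, kleisli_assoc]

theorem extension_anti {X Y A : Type u} (γ : 𝕋.Rel X A) {α α' : 𝕋.Rel X Y} (h : α ≤ α') :
    𝕋.extension γ α' ≤ 𝕋.extension γ α :=
  𝕋.le_extension.2 ((𝕋.kleisli_mono le_rfl h).trans (𝕋.le_extension.1 le_rfl))

end TopologicalTheory

variable {𝕋 : TopologicalTheory V}

/-! ### The calculus of distributors -/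

theorem TCat.one_le_str (X : TCat 𝕋) (x : X.carrier) : 1 ≤ X.str (𝕋.e _ x) x :=
  (𝕋.one_le_unitRel x).trans (X.unit_le _ _)

theorem TCat.str_trans (X : TCat 𝕋) (𝔛 : 𝕋.obj (𝕋.obj X.carrier)) (𝔵 : 𝕋.obj X.carrier)
    (x : X.carrier) : 𝕋.Txi X.str 𝔛 𝔵 * X.str 𝔵 x ≤ X.str (𝕋.m _ 𝔛) x :=
  𝕋.kleisli_le.1 X.comp_le 𝔛 𝔵 x

theorem IsDistributor.kleisli_str {X Y : TCat 𝕋} {φ : 𝕋.Rel X.carrier Y.carrier}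
    (h : IsDistributor X Y φ) : 𝕋.kleisli φ X.str = φ :=
  h.1.antisymm (𝕋.le_kleisli_of_unit_le_right X.unit_le φ)

theorem IsDistributor.str_kleisli {X Y : TCat 𝕋} {φ : 𝕋.Rel X.carrier Y.carrier}
    (h : IsDistributor X Y φ) : 𝕋.kleisli Y.str φ = φ :=
  h.2.antisymm (𝕋.le_kleisli_of_unit_le Y.unit_le φ)

theorem IsDistributor.kleisli {X Y Z : TCat 𝕋} {ψ : 𝕋.Rel Y.carrier Z.carrier}
    {φ : 𝕋.Rel X.carrier Y.carrier} (hψ : IsDistributor Y Z ψ) (hφ : IsDistributor X Y φ) :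
    IsDistributor X Z (𝕋.kleisli ψ φ) := by
  constructor
  · rw [← 𝕋.kleisli_assoc, hφ.kleisli_str]
  · rw [𝕋.kleisli_assoc, hψ.str_kleisli]

theorem lowerStar_apply {X Y : TCat 𝕋} (f : X ⟶ Y) (𝔵 : 𝕋.obj X.carrier) (y : Y.carrier) :
    lowerStar f 𝔵 y = Y.str (𝕋.map f.toFun 𝔵) y := by
  rw [lowerStar, VRel.comp_graph]

theorem upperStar_apply {X Y : TCat 𝕋} (f : X ⟶ Y) (𝔶 : 𝕋.obj Y.carrier) (x : X.carrier) :
    upperStar f 𝔶 x = Y.str 𝔶 (f.toFun x) := by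
  rw [upperStar, VRel.conv_graph_comp]

theorem lowerStar_id (X : TCat 𝕋) : lowerStar (𝟙 X) = X.str := by
  funext 𝔵 x
  rw [lowerStar_apply]
  exact congrArg (fun 𝔷 => X.str 𝔷 x) (𝕋.map_id' 𝔵)

theorem upperStar_id (X : TCat 𝕋) : upperStar (𝟙 X) = X.str := by
  funext 𝔵 x
  rw [upperStar_apply]
  rfl

theorem Txi_lowerStar_le {X Y : TCat 𝕋} (f : X ⟶ Y) (𝔛 : 𝕋.obj (𝕋.obj X.carrier))
    (𝔶 : 𝕋.obj Y.carrier) :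
    𝕋.Txi (lowerStar f) 𝔛 𝔶 ≤ 𝕋.Txi Y.str (𝕋.map (𝕋.map f.toFun) 𝔛) 𝔶 := by
  have h := 𝕋.Txi_le_map (r := lowerStar f) (s := Y.str) (𝕋.map f.toFun) (fun y => y)
    (fun 𝔵 y => (lowerStar_apply f 𝔵 y).le) 𝔛 𝔶
  rwa [𝕋.map_id'] at h

theorem Txi_upperStar_le {X Y : TCat 𝕋} (f : X ⟶ Y) (𝔜 : 𝕋.obj (𝕋.obj Y.carrier))
    (𝔵 : 𝕋.obj X.carrier) :
    𝕋.Txi (upperStar f) 𝔜 𝔵 ≤ 𝕋.Txi Y.str 𝔜 (𝕋.map f.toFun 𝔵) := by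
  have h := 𝕋.Txi_le_map (r := upperStar f) (s := Y.str) (fun 𝔶 => 𝔶) f.toFun
    (fun 𝔶 x => (upperStar_apply f 𝔶 x).le) 𝔜 𝔵
  rwa [𝕋.map_id'] at h

theorem isDistributor_lowerStar {X Y : TCat 𝕋} (f : X ⟶ Y) :
    IsDistributor X Y (lowerStar f) := by
  constructor
  · refine 𝕋.kleisli_le.2 fun 𝔛 𝔵 y => ?_
    rw [lowerStar_apply, lowerStar_apply, 𝕋.map_m]
    exact (mul_le_mul' (𝕋.Txi_le_map _ _ f.str_le 𝔛 𝔵) le_rfl).trans (Y.str_trans _ _ _)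
  · refine 𝕋.kleisli_le.2 fun 𝔛 𝔶 y => ?_
    rw [lowerStar_apply, 𝕋.map_m]
    exact (mul_le_mul' (Txi_lowerStar_le f 𝔛 𝔶) le_rfl).trans (Y.str_trans _ _ _)

theorem isDistributor_upperStar {X Y : TCat 𝕋} (f : X ⟶ Y) :
    IsDistributor Y X (upperStar f) := by
  constructor
  · refine 𝕋.kleisli_le.2 fun 𝔜 𝔶 x => ?_
    rw [upperStar_apply, upperStar_apply]
    exact Y.str_trans _ _ _
  · refine 𝕋.kleisli_le.2 fun 𝔜 𝔵 x => ?_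
    rw [upperStar_apply]
    exact (mul_le_mul' (Txi_upperStar_le f 𝔜 𝔵) (f.str_le 𝔵 x)).trans (Y.str_trans _ _ _)

theorem kleisli_upperStar_apply {X Y Z : TCat 𝕋} (f : Z ⟶ Y) {φ : 𝕋.Rel X.carrier Y.carrier}
    (hφ : IsDistributor X Y φ) (𝔵 : 𝕋.obj X.carrier) (z : Z.carrier) :
    𝕋.kleisli (upperStar f) φ 𝔵 z = φ 𝔵 (f.toFun z) := by
  rw [upperStar, 𝕋.kleisli_conv_graph_comp, hφ.str_kleisli]

theorem kleisli_lowerStar_apply {X Y Z : TCat 𝕋} (f : X ⟶ Y) {φ : 𝕋.Rel Y.carrier Z.carrier}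
    (hφ : IsDistributor Y Z φ) (𝔵 : 𝕋.obj X.carrier) (z : Z.carrier) :
    𝕋.kleisli φ (lowerStar f) 𝔵 z = φ (𝕋.map f.toFun 𝔵) z := by
  apply le_antisymm
  · have h : 𝕋.kleisli φ (lowerStar f) ≤ fun 𝔵 z => φ (𝕋.map f.toFun 𝔵) z := by
      refine 𝕋.kleisli_le.2 fun 𝔛 𝔶 z => ?_
      rw [𝕋.map_m]
      exact (mul_le_mul' (Txi_lowerStar_le f 𝔛 𝔶) le_rfl).trans (𝕋.kleisli_le.1 hφ.1 _ _ _)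
    exact h 𝔵 z
  -- The test element $Te(\mathfrak x)$ lies over $\mathfrak x$ under $m$, and $f_*(e(x),f(x))\ge k$
  -- for each $x$, so the corresponding value of $T_\xi f_*$ is at least $k$.
  · have h := 𝕋.le_kleisli φ (lowerStar f) (𝕋.map (𝕋.e _) 𝔵) (𝕋.map f.toFun 𝔵) z
    rw [𝕋.m_map_e] at h
    refine le_trans ?_ h
    refine (one_mul _).ge.trans (mul_le_mul' ?_ le_rfl)
    refine le_trans (𝕋.one_le_xi (fun x => ?_) 𝔵)
      (𝕋.xi_le_Txi' (lowerStar f) (𝕋.e _) f.toFun 𝔵)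
    rw [lowerStar_apply, 𝕋.map_e]
    exact Y.one_le_str _

theorem str_le_upperStar_lowerStar {X Y : TCat 𝕋} (f : X ⟶ Y) :
    X.str ≤ 𝕋.kleisli (upperStar f) (lowerStar f) := fun 𝔵 x => by
  rw [kleisli_upperStar_apply f (isDistributor_lowerStar f), lowerStar_apply]
  exact f.str_le 𝔵 x

theorem lowerStar_upperStar_le {X Y : TCat 𝕋} (f : X ⟶ Y) :
    𝕋.kleisli (lowerStar f) (upperStar f) ≤ Y.str :=
  𝕋.kleisli_le.2 fun 𝔜 𝔵 y => by
    rw [lowerStar_apply]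
    exact (mul_le_mul' (Txi_upperStar_le f 𝔜 𝔵) le_rfl).trans (Y.str_trans _ _ _)

theorem lowerStar_comp {X Y Z : TCat 𝕋} (f : X ⟶ Y) (g : Y ⟶ Z) :
    lowerStar (f ≫ g) = 𝕋.kleisli (lowerStar g) (lowerStar f) := by
  funext 𝔵 z
  rw [kleisli_lowerStar_apply f (isDistributor_lowerStar g), lowerStar_apply, lowerStar_apply,
    𝕋.map_map]
  rfl

theorem upperStar_comp {X Y Z : TCat 𝕋} (f : X ⟶ Y) (g : Y ⟶ Z) :
    upperStar (f ≫ g) = 𝕋.kleisli (upperStar f) (upperStar g) := by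
  funext 𝔷 x
  rw [kleisli_upperStar_apply f (isDistributor_upperStar g), upperStar_apply, upperStar_apply]
  rfl

/-- Precomposition with `h^*` is left adjoint to precomposition with `h_*`. -/
theorem le_kleisli_lowerStar_iff {X Y : TCat 𝕋} {Z : Type u} (h : X ⟶ Y)
    {β : 𝕋.Rel X.carrier Z} {γ : 𝕋.Rel Y.carrier Z} (hγ : 𝕋.kleisli γ Y.str ≤ γ) :
    β ≤ 𝕋.kleisli γ (lowerStar h) ↔ 𝕋.kleisli β (upperStar h) ≤ γ := by
  constructor
  · intro H
    refine (𝕋.kleisli_mono H le_rfl).trans ?_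
    rw [← 𝕋.kleisli_assoc]
    exact (𝕋.kleisli_mono le_rfl (lowerStar_upperStar_le h)).trans hγ
  · intro H
    refine (𝕋.le_kleisli_of_unit_le_right X.unit_le β).trans ?_
    refine (𝕋.kleisli_mono le_rfl (str_le_upperStar_lowerStar h)).trans ?_
    rw [𝕋.kleisli_assoc]
    exact 𝕋.kleisli_mono H le_rfl

/-- Postcomposition with `h_*` is left adjoint to postcomposition with `h^*`. -/
theorem le_upperStar_kleisli_iff {X Y : TCat 𝕋} {Z : Type u} (h : X ⟶ Y)
    {β : 𝕋.Rel Z X.carrier} {γ : 𝕋.Rel Z Y.carrier} (hγ : 𝕋.kleisli Y.str γ ≤ γ) :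
    β ≤ 𝕋.kleisli (upperStar h) γ ↔ 𝕋.kleisli (lowerStar h) β ≤ γ := by
  constructor
  · intro H
    refine (𝕋.kleisli_mono le_rfl H).trans ?_
    rw [𝕋.kleisli_assoc]
    exact (𝕋.kleisli_mono (lowerStar_upperStar_le h) le_rfl).trans hγ
  · intro H
    refine (𝕋.le_kleisli_of_unit_le X.unit_le β).trans ?_
    refine (𝕋.kleisli_mono (str_le_upperStar_lowerStar h) le_rfl).trans ?_
    rw [← 𝕋.kleisli_assoc]
    exact 𝕋.kleisli_mono le_rfl H

/-- Both sides are equivalent to $g_*\circ f^*\le b$, where $b$ is the structure of $Y$, by the two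
adjunctions between lower and upper stars. -/
theorem tLe_iff_lowerStar_le {X Y : TCat 𝕋} {f g : X ⟶ Y} :
    TLe f g ↔ lowerStar g ≤ lowerStar f := by
  rw [TLe, ← (isDistributor_upperStar g).kleisli_str,
    le_upperStar_kleisli_iff g Y.comp_le, ← le_kleisli_lowerStar_iff f Y.comp_le,
    (isDistributor_lowerStar f).str_kleisli]

theorem tLe_refl {X Y : TCat 𝕋} (f : X ⟶ Y) : TLe f f := le_refl (upperStar f)

theorem TLe.comp_right {X Y Z : TCat 𝕋} {f g : X ⟶ Y} (h : TLe f g) (p : Y ⟶ Z) :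
    TLe (f ≫ p) (g ≫ p) := by
  rw [tLe_iff_lowerStar_le, lowerStar_comp, lowerStar_comp]
  exact 𝕋.kleisli_mono le_rfl (tLe_iff_lowerStar_le.1 h)

theorem IsSeparated.eq_of_lowerStar_eq {X Y : TCat 𝕋} (hY : IsSeparated Y) {f g : X ⟶ Y}
    (h : lowerStar f = lowerStar g) : f = g :=
  hY X f g (tLe_iff_lowerStar_le.2 h.ge) (tLe_iff_lowerStar_le.2 h.le)

theorem IsSeparated.of_retract {A B : TCat 𝕋} (hB : IsSeparated B) (i : A ⟶ B) (r : B ⟶ A)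
    (hir : i ≫ r = 𝟙 A) : IsSeparated A := fun Y f g hfg hgf => by
  have h := hB Y (f ≫ i) (g ≫ i) (hfg.comp_right i) (hgf.comp_right i)
  have h2 := congrArg (· ≫ r) h
  simpa only [Category.assoc, hir, Category.comp_id] using h2

/-- The extension of `γ` along `h^*` is `γ ∘ h_*`. -/
theorem extension_upperStar {X Y : TCat 𝕋} {Z : Type u} (h : X ⟶ Y)
    {γ : 𝕋.Rel Y.carrier Z} (hγ : 𝕋.kleisli γ Y.str ≤ γ) :
    𝕋.extension γ (upperStar h) = 𝕋.kleisli γ (lowerStar h) :=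
  eq_of_forall_le_iff fun β => by
    rw [𝕋.le_extension, le_kleisli_lowerStar_iff h hγ]

namespace DistributorClass

variable (Φ : DistributorClass 𝕋)

/-! ### The Yoneda lemma and colimits of presheaves -/

theorem isDistributor_ev (X : TCat 𝕋) : IsDistributor X (Φ.phiObj X) (Φ.ev X) := by
  refine ⟨?_, Φ.str_ev X⟩
  refine 𝕋.kleisli_le.2 fun 𝔛 𝔵 ψ => ?_
  exact 𝕋.kleisli_le.1 (Φ.isDistributor ψ.2).1 𝔛 𝔵 PUnit.unit

/-- The defining property of the presheaf structure as an extension, pulled back along an arbitrary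
map `g`. The infimum runs over all `𝔮` above `Tg 𝔷`, and the weak pullback condition lets each of
them be lifted to $T(TX\times Z)$. -/
theorem le_str_map {X Z : TCat 𝕋} (g : Z.carrier → (Φ.phiObj X).carrier)
    (β : 𝕋.Rel Z.carrier (Φ.phiObj X).carrier)
    (h : 𝕋.kleisli β (fun 𝔵 z => Φ.ev X 𝔵 (g z)) ≤ Φ.ev X) (𝔷 : 𝕋.obj Z.carrier)
    (ψ : (Φ.phiObj X).carrier) : β 𝔷 ψ ≤ (Φ.phiObj X).str (𝕋.map g 𝔷) ψ := by
  refine le_iInf₂ ?_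
  intro 𝔮 h𝔮
  have h𝔮' := h𝔮.trans (𝕋.map_map (X := Z.carrier) _ _ 𝔷)
  obtain ⟨𝔴, rfl, rfl⟩ := 𝕋.exists_lift (W := 𝕋.obj X.carrier × Z.carrier)
    (Prod.snd : 𝕋.obj X.carrier × PshCarrier X → PshCarrier X)
    (fun z => (g z).1) (fun p => (p.1, (g p.2).1)) Prod.snd
    (by rintro ⟨𝔵, ψ⟩ z rfl; exact ⟨(𝔵, z), rfl, rfl⟩) 𝔮 𝔷 h𝔮'
  refine le_vhom.2 ?_
  rw [𝕋.xi_map, 𝕋.map_map, mul_comm]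
  refine le_trans (mul_le_mul' ?_ le_rfl)
    (𝕋.kleisli_le.1 h (𝕋.map Prod.fst 𝔴) (𝕋.map Prod.snd 𝔴) ψ)
  exact 𝕋.xi_le_Txi (fun 𝔵 z => Φ.ev X 𝔵 (g z)) 𝔴

/-- The Yoneda lemma. -/
theorem lowerStar_yoneda (X : TCat 𝕋) : lowerStar (Φ.yoneda X) = Φ.ev X := by
  funext 𝔵 ψ
  rw [lowerStar_apply]
  apply le_antisymm
  -- Again the test element is $Te(\mathfrak x)$: here $\mathrm{ev}(e(x),y(x))=a(e(x),x)\ge k$.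
  · have h := 𝕋.kleisli_le.1 (Φ.str_ev X) (𝕋.map (𝕋.e _) 𝔵) (𝕋.map (Φ.yoneda X).toFun 𝔵) ψ
    rw [𝕋.m_map_e] at h
    refine le_trans ((one_mul _).ge.trans (mul_le_mul' ?_ le_rfl)) h
    exact le_trans (𝕋.one_le_xi X.one_le_str 𝔵)
      (𝕋.xi_le_Txi' (Φ.ev X) (𝕋.e _) (Φ.yoneda X).toFun 𝔵)
  · exact Φ.le_str_map (Φ.yoneda X).toFun (Φ.ev X) (Φ.isDistributor_ev X).1 𝔵 ψ

variable {Φ} in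
/-- The distributor `X ⇸ Y` corresponding to a `𝕋`-functor `Y ⟶ ΦX`. -/
def rel {X Y : TCat 𝕋} (h : Y ⟶ Φ.phiObj X) : 𝕋.Rel X.carrier Y.carrier :=
  fun 𝔵 y => val (h.toFun y) 𝔵 PUnit.unit

theorem rel_eq {X Y : TCat 𝕋} (h : Y ⟶ Φ.phiObj X) :
    rel h = 𝕋.kleisli (upperStar h) (Φ.ev X) := by
  funext 𝔵 y
  rw [kleisli_upperStar_apply h (Φ.isDistributor_ev X)]
  rfl

theorem isDistributor_rel {X Y : TCat 𝕋} (h : Y ⟶ Φ.phiObj X) : IsDistributor X Y (rel h) := by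
  rw [rel_eq]
  exact (isDistributor_upperStar h).kleisli (Φ.isDistributor_ev X)

theorem rel_id (X : TCat 𝕋) : rel (𝟙 (Φ.phiObj X)) = Φ.ev X := rfl

theorem rel_yoneda (X : TCat 𝕋) : rel (Φ.yoneda X) = X.str := rfl

variable {Φ} in
theorem rel_injective {X Y : TCat 𝕋} {f g : Y ⟶ Φ.phiObj X} (h : rel f = rel g) : f = g :=
  Φ.phi_hom_ext fun y => by
    funext 𝔵 _
    exact congrFun (congrFun h 𝔵) y

theorem rel_comp {X Y Z : TCat 𝕋} (p : Z ⟶ Y) (h : Y ⟶ Φ.phiObj X) :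
    rel (p ≫ h) = 𝕋.kleisli (upperStar p) (rel h) := by
  rw [rel_eq, rel_eq, upperStar_comp, 𝕋.kleisli_assoc]

theorem rel_comp_phiMap {X Y Z : TCat 𝕋} (h : Z ⟶ Φ.phiObj X) (f : X ⟶ Y) :
    rel (h ≫ Φ.phiMap f) = 𝕋.kleisli (rel h) (upperStar f) := rfl

/-- Every `𝕋`-functor into `ΦX` is a colimit of the Yoneda functor. -/
theorem lowerStar_eq_extension {X Y : TCat 𝕋} (h : Y ⟶ Φ.phiObj X) :
    lowerStar h = 𝕋.extension (Φ.ev X) (rel h) := by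
  apply le_antisymm
  · rw [𝕋.le_extension, rel_eq, 𝕋.kleisli_assoc]
    exact (𝕋.kleisli_mono (lowerStar_upperStar_le h) le_rfl).trans (Φ.str_ev X)
  · intro 𝔶 ψ
    rw [lowerStar_apply]
    exact Φ.le_str_map h.toFun _ (𝕋.le_extension.1 le_rfl) 𝔶 ψ

variable {Φ} in
-- Forwards, `rel` is composition of the upper star with `ev`. Backwards, the lower star is the
-- extension of `ev` along `rel`, which is antitone, and passing to lower stars reverses the order
-- once more.
theorem tLe_iff_rel_le {X Y : TCat 𝕋} {f g : Y ⟶ Φ.phiObj X} : TLe f g ↔ rel f ≤ rel g := by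
  constructor
  · intro h
    rw [rel_eq, rel_eq]
    exact 𝕋.kleisli_mono h le_rfl
  · intro h
    rw [tLe_iff_lowerStar_le, lowerStar_eq_extension, lowerStar_eq_extension]
    exact 𝕋.extension_anti _ h

/-- The structure of $\Phi X$ is $\mathrm{ev}/\mathrm{ev}$, so both sides amount to
$h_*\circ\gamma\circ\mathrm{ev}\le\mathrm{ev}$. -/
theorem le_upperStar_iff {X Y : TCat 𝕋} (h : Y ⟶ Φ.phiObj X)
    {γ : 𝕋.Rel (Φ.phiObj X).carrier Y.carrier} :
    γ ≤ upperStar h ↔ 𝕋.kleisli γ (Φ.ev X) ≤ rel h := by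
  constructor
  · intro H
    rw [rel_eq]
    exact 𝕋.kleisli_mono H le_rfl
  · intro H
    rw [← (isDistributor_upperStar h).kleisli_str,
      le_upperStar_kleisli_iff h (Φ.phiObj X).comp_le, ← lowerStar_id,
      lowerStar_eq_extension (h := 𝟙 _), 𝕋.le_extension, rel_id, ← 𝕋.kleisli_assoc]
    rw [rel_eq] at H
    exact (le_upperStar_kleisli_iff h (Φ.isDistributor_ev X).2).1 H

theorem isSeparated_phiObj (X : TCat 𝕋) : IsSeparated (Φ.phiObj X) := fun _ _ _ hfg hgf =>
  rel_injective (le_antisymm (tLe_iff_rel_le.1 hfg) (tLe_iff_rel_le.1 hgf))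

/-! ### Membership in `Φ` and weighted colimits in `ΦX`. -/

theorem mem_values {X Y : TCat 𝕋} {φ : 𝕋.Rel X.carrier Y.carrier} (hφ : Φ.mem X Y φ)
    (y : Y.carrier) : Φ.mem X (TCat.G 𝕋) fun 𝔵 _ => φ 𝔵 y := by
  have h := Φ.ax2_upper_comp (Y.point y) hφ
  have e : 𝕋.kleisli (upperStar (Y.point y)) φ = fun 𝔵 _ => φ 𝔵 y := by
    funext 𝔵 z
    exact kleisli_upperStar_apply (Y.point y) (Φ.isDistributor hφ) 𝔵 z
  rwa [e] at h

/-- Axiom (3), once $y^*\circ\varphi$ is recognised as the column $\varphi(-,y)$. Together with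
`mem_values`, membership becomes a columnwise condition. -/
theorem mem_of_values {X Y : TCat 𝕋} {φ : 𝕋.Rel X.carrier Y.carrier}
    (hφ : IsDistributor X Y φ) (h : ∀ y, Φ.mem X (TCat.G 𝕋) fun 𝔵 _ => φ 𝔵 y) :
    Φ.mem X Y φ := by
  refine Φ.ax3 hφ fun y => ?_
  have e : 𝕋.kleisli (upperStar (Y.point y)) φ = fun 𝔵 _ => φ 𝔵 y := by
    funext 𝔵 z
    exact kleisli_upperStar_apply (Y.point y) hφ 𝔵 z
  rw [e]
  exact h y

theorem mem_rel {X Y : TCat 𝕋} (h : Y ⟶ Φ.phiObj X) : Φ.mem X Y (rel h) :=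
  Φ.mem_of_values (Φ.isDistributor_rel h) fun y => (h.toFun y).2

theorem mem_lowerStar_yoneda (X : TCat 𝕋) :
    Φ.mem X (Φ.phiObj X) (lowerStar (Φ.yoneda X)) := by
  rw [lowerStar_yoneda]
  exact Φ.mem_rel (𝟙 _)

theorem exists_rel_eq {X Y : TCat 𝕋} {φ : 𝕋.Rel X.carrier Y.carrier} (hφ : Φ.mem X Y φ) :
    ∃ p : Y ⟶ Φ.phiObj X, rel p = φ :=
  ⟨Φ.mate φ (Φ.isDistributor hφ) (Φ.mem_values hφ), rfl⟩

/-- The composite equals $(\varphi\circ h^*)\circ(y_X)_*$; axiom (2) applies to both factors because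
$(y_X)_*$ is itself in $\Phi$. -/
theorem exists_rel_eq_kleisli {X Y Z : TCat 𝕋} {φ : 𝕋.Rel Y.carrier Z.carrier}
    (hφ : Φ.mem Y Z φ) (h : Y ⟶ Φ.phiObj X) :
    ∃ g : Z ⟶ Φ.phiObj X, rel g = 𝕋.kleisli φ (rel h) := by
  apply Φ.exists_rel_eq
  rw [rel_eq, 𝕋.kleisli_assoc, ← lowerStar_yoneda]
  exact Φ.ax2_comp_lower (Φ.yoneda X) (Φ.ax2_comp_upper h hφ) (Φ.mem_lowerStar_yoneda X)

theorem isWeightedColimit_of_rel_eq {X Y Z : TCat 𝕋} {φ : 𝕋.Rel Y.carrier Z.carrier}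
    {h : Y ⟶ Φ.phiObj X} {g : Z ⟶ Φ.phiObj X} (H : rel g = 𝕋.kleisli φ (rel h)) :
    IsWeightedColimit φ h g := by
  rw [IsWeightedColimit, lowerStar_eq_extension, lowerStar_eq_extension, H,
    𝕋.extension_kleisli]

/-- The composite is represented by some functor, which is a colimit; colimits in a separated
category are unique. -/
theorem isWeightedColimit_iff_rel_eq {X Y Z : TCat 𝕋} {φ : 𝕋.Rel Y.carrier Z.carrier}
    (hφ : Φ.mem Y Z φ) {h : Y ⟶ Φ.phiObj X} {g : Z ⟶ Φ.phiObj X} :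
    IsWeightedColimit φ h g ↔ rel g = 𝕋.kleisli φ (rel h) := by
  refine ⟨fun H => ?_, Φ.isWeightedColimit_of_rel_eq⟩
  obtain ⟨g', hg'⟩ := Φ.exists_rel_eq_kleisli hφ h
  have h2 : IsWeightedColimit φ h g' := Φ.isWeightedColimit_of_rel_eq hg'
  rw [(Φ.isSeparated_phiObj X).eq_of_lowerStar_eq (H.trans h2.symm), hg']

theorem isCocomplete_phiObj (X : TCat 𝕋) : Φ.IsCocomplete (Φ.phiObj X) :=
  fun _ _ _ h hφ => (Φ.exists_rel_eq_kleisli hφ h).imp fun _ => Φ.isWeightedColimit_of_rel_eq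

theorem isCocontinuous_phiMap {X Y : TCat 𝕋} (f : X ⟶ Y) : Φ.IsCocontinuous (Φ.phiMap f) := by
  intro Y Z φ h g hφ hg
  rw [Φ.isWeightedColimit_iff_rel_eq hφ] at hg ⊢
  rw [rel_comp_phiMap, rel_comp_phiMap, hg, 𝕋.kleisli_assoc]

theorem yoneda_comp_phiMap {X Y : TCat 𝕋} (f : X ⟶ Y) :
    Φ.yoneda X ≫ Φ.phiMap f = f ≫ Φ.yoneda Y := by
  apply rel_injective
  rw [rel_comp_phiMap, rel_comp, rel_yoneda, rel_yoneda,
    (isDistributor_upperStar f).str_kleisli, (isDistributor_upperStar f).kleisli_str]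

/-! ### Extensions along the Yoneda functor -/

/-- `F : ΦX ⟶ A` is the left Kan extension of `f : X ⟶ A` along the Yoneda functor. -/
abbrev IsYonedaExtension {X A : TCat 𝕋} (f : X ⟶ A) (F : Φ.phiObj X ⟶ A) : Prop :=
  IsWeightedColimit (lowerStar (Φ.yoneda X)) f F

variable {Φ}

/-- With $F_*=f_*/\mathrm{ev}$, one has $F_*\circ h_*=F_*/h^*=f_*/(h^*\circ\mathrm{ev})$, and
$h^*\circ\mathrm{ev}=\mathrm{rel}\,h$. -/
theorem IsYonedaExtension.lowerStar_comp_eq {X A Y : TCat 𝕋} {f : X ⟶ A}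
    {F : Φ.phiObj X ⟶ A} (hF : Φ.IsYonedaExtension f F) (h : Y ⟶ Φ.phiObj X) :
    lowerStar (h ≫ F) = 𝕋.extension (lowerStar f) (rel h) := by
  rw [lowerStar_comp, rel_eq, 𝕋.extension_kleisli, ← lowerStar_yoneda, ← hF,
    extension_upperStar h (isDistributor_lowerStar F).1]

theorem IsYonedaExtension.isCocontinuous {X A : TCat 𝕋} {f : X ⟶ A} {F : Φ.phiObj X ⟶ A}
    (hF : Φ.IsYonedaExtension f F) : Φ.IsCocontinuous F := by
  intro Y Z φ h g hφ hg
  rw [Φ.isWeightedColimit_iff_rel_eq hφ] at hg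
  rw [IsWeightedColimit, hF.lowerStar_comp_eq, hF.lowerStar_comp_eq, hg, 𝕋.extension_kleisli]

theorem IsYonedaExtension.yoneda_comp {X A : TCat 𝕋} (hA : IsSeparated A) {f : X ⟶ A}
    {F : Φ.phiObj X ⟶ A} (hF : Φ.IsYonedaExtension f F) : Φ.yoneda X ≫ F = f := by
  apply hA.eq_of_lowerStar_eq
  rw [hF.lowerStar_comp_eq, rel_yoneda, ← upperStar_id,
    extension_upperStar (𝟙 X) (isDistributor_lowerStar f).1, lowerStar_id,
    (isDistributor_lowerStar f).kleisli_str]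

/-- The identity of `ΦX` is the colimit of the Yoneda functor weighted by its own lower star, a
member of `Φ`, and `F` preserves this colimit. -/
theorem IsCocontinuous.isYonedaExtension {X A : TCat 𝕋} {F : Φ.phiObj X ⟶ A}
    (hF : Φ.IsCocontinuous F) : Φ.IsYonedaExtension (Φ.yoneda X ≫ F) F := by
  refine hF X (Φ.phiObj X) _ (Φ.yoneda X) (𝟙 _) (Φ.mem_lowerStar_yoneda X) ?_
  apply Φ.isWeightedColimit_of_rel_eq
  rw [rel_id, rel_yoneda, lowerStar_yoneda, (Φ.isDistributor_ev X).kleisli_str]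

/-- The Kock–Zöberlein phenomenon: being an algebra is a property. From $\alpha_*\circ y_*=a$
follows $\alpha_*\le a/y_*$. Conversely, $a/y_*\le y^*$ by the description of upper stars into `ΦA`,
and $y^*\circ\alpha^*=a$ gives $y^*\le\alpha_*$ by adjunction. -/
theorem isYonedaExtension_of_retraction {A : TCat 𝕋} {α : Φ.phiObj A ⟶ A}
    (hα : Φ.yoneda A ≫ α = 𝟙 A) : Φ.IsYonedaExtension (𝟙 A) α := by
  have h1 : 𝕋.kleisli (lowerStar α) (lowerStar (Φ.yoneda A)) = A.str := by
    rw [← lowerStar_comp, hα, lowerStar_id]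
  rw [IsYonedaExtension, IsWeightedColimit, lowerStar_id]
  apply le_antisymm
  · exact 𝕋.le_extension.2 h1.le
  · have h2 : 𝕋.extension A.str (lowerStar (Φ.yoneda A)) ≤ upperStar (Φ.yoneda A) := by
      rw [Φ.le_upperStar_iff, rel_yoneda, ← lowerStar_yoneda]
      exact 𝕋.le_extension.1 le_rfl
    refine h2.trans ?_
    have h3 : 𝕋.kleisli (upperStar (Φ.yoneda A)) (upperStar α) ≤ A.str := by
      rw [← upperStar_comp, hα, upperStar_id]
    have h4 := (le_kleisli_lowerStar_iff α A.comp_le).2 h3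
    rwa [(isDistributor_lowerStar α).str_kleisli] at h4

/-- A colimit in `A` is `α` applied to the presheaves $\varphi\circ h^*$, since $a/(\varphi\circ
h^*)=(a/h^*)/\varphi=h_*/\varphi$. -/
theorem IsYonedaExtension.isWeightedColimit_comp {A Y Z : TCat 𝕋} {α : Φ.phiObj A ⟶ A}
    (hα : Φ.IsYonedaExtension (𝟙 A) α) {φ : 𝕋.Rel Y.carrier Z.carrier} {h : Y ⟶ A}
    {p : Z ⟶ Φ.phiObj A} (hp : rel p = 𝕋.kleisli φ (upperStar h)) :
    IsWeightedColimit φ h (p ≫ α) := by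
  rw [IsWeightedColimit, hα.lowerStar_comp_eq, hp, 𝕋.extension_kleisli, lowerStar_id,
    extension_upperStar h A.comp_le, (isDistributor_lowerStar h).str_kleisli]

theorem IsYonedaExtension.isCocomplete {A : TCat 𝕋} {α : Φ.phiObj A ⟶ A}
    (hα : Φ.IsYonedaExtension (𝟙 A) α) : Φ.IsCocomplete A := by
  intro Y Z φ h hφ
  obtain ⟨p, hp⟩ := Φ.exists_rel_eq (Φ.ax2_comp_upper h hφ)
  exact ⟨p ≫ α, hα.isWeightedColimit_comp hp⟩

/-- By separation every colimit in `A` has the form `p ≫ α`. The square moves `F` past `α`, and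
$\Phi F$ turns the weight $\varphi\circ h^*$ into $\varphi\circ(h\cdot F)^*$, with $h\cdot F$ read
as `h ≫ F`. -/
theorem isCocontinuous_of_comp_eq {A B : TCat 𝕋} (hA : IsSeparated A) {α : Φ.phiObj A ⟶ A}
    {β : Φ.phiObj B ⟶ B} (hα : Φ.IsYonedaExtension (𝟙 A) α)
    (hβ : Φ.IsYonedaExtension (𝟙 B) β) {F : A ⟶ B} (hF : Φ.phiMap F ≫ β = α ≫ F) :
    Φ.IsCocontinuous F := by
  intro Y Z φ h g hφ hg
  obtain ⟨p, hp⟩ := Φ.exists_rel_eq (Φ.ax2_comp_upper h hφ)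
  have h1 : g = p ≫ α :=
    hA.eq_of_lowerStar_eq (hg.trans (hα.isWeightedColimit_comp hp).symm)
  rw [h1, Category.assoc, ← hF, ← Category.assoc]
  apply hβ.isWeightedColimit_comp
  rw [rel_comp_phiMap, hp, upperStar_comp, 𝕋.kleisli_assoc]

variable (Φ)

/-! ### The adjunction -/

/-- The functor `Φ` with values in separated `Φ`-cocomplete `𝕋`-categories. -/
abbrev freeCocompletion : TCat 𝕋 ⥤ Φ.CocomplSep :=
  Φ.reflector Φ.isSeparated_phiObj Φ.isCocomplete_phiObj fun f => Φ.isCocontinuous_phiMap f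

theorem exists_isYonedaExtension {X : TCat 𝕋} (A : Φ.CocomplSep) (f : X ⟶ A.toTCat) :
    ∃ F : Φ.phiObj X ⟶ A.toTCat, Φ.IsYonedaExtension f F :=
  A.cocomplete _ _ _ f (Φ.mem_lowerStar_yoneda X)

/-- `Φ`-cocontinuous `𝕋`-functors out of `ΦX` correspond to `𝕋`-functors out of `X`. -/
noncomputable def yonedaHomEquiv (X : TCat 𝕋) (A : Φ.CocomplSep) :
    (Φ.freeCocompletion.obj X ⟶ A) ≃ (X ⟶ Φ.inclusion.obj A) where
  toFun F := Φ.yoneda X ≫ F.1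
  invFun f := ⟨(Φ.exists_isYonedaExtension A f).choose,
    (Φ.exists_isYonedaExtension A f).choose_spec.isCocontinuous⟩
  left_inv F := Subtype.ext <| A.separated.eq_of_lowerStar_eq <|
    (Φ.exists_isYonedaExtension A _).choose_spec.trans F.2.isYonedaExtension.symm
  right_inv f := (Φ.exists_isYonedaExtension A f).choose_spec.yoneda_comp A.separated

/-- `Φ` is left adjoint to the inclusion. -/
noncomputable def adjunction : Φ.freeCocompletion ⊣ Φ.inclusion :=
  Adjunction.mkOfHomEquiv
    { homEquiv := Φ.yonedaHomEquiv
      homEquiv_naturality_left_symm := fun {X' X A} f g => by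
        rw [Equiv.symm_apply_eq]
        -- Writing `g` as the restriction of some `F` reduces the claim to naturality of the Yoneda
        -- functor.
        obtain ⟨F, rfl⟩ := (Φ.yonedaHomEquiv X A).surjective g
        rw [Equiv.symm_apply_apply]
        exact congrArg (fun p => p ≫ F.1) (Φ.yoneda_comp_phiMap f).symm
      homEquiv_naturality_right := fun F g => (Category.assoc _ F.1 g.1).symm }

theorem adjunction_unit_app (X : TCat 𝕋) : Φ.adjunction.unit.app X = Φ.yoneda X := by
  rw [adjunction, Adjunction.mkOfHomEquiv_unit_app]
  rfl

theorem isYonedaExtension_counit (A : Φ.CocomplSep) :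
    Φ.IsYonedaExtension (𝟙 A.toTCat) (Φ.inclusion.map (Φ.adjunction.counit.app A)) := by
  apply isYonedaExtension_of_retraction
  have h := Φ.adjunction.right_triangle_components A
  rwa [adjunction_unit_app] at h

/-! ### The multiplication and its adjoints. -/

/-- The counit at `ΦX` is the colimit of the identity weighted by the lower star of the Yoneda
functor of `ΦX`, and such colimits are composites. -/
theorem rel_mu (X : TCat 𝕋) :
    rel (Φ.adjunction.toMonad.μ.app X) =
      𝕋.kleisli (Φ.ev (Φ.phiObj X)) (lowerStar (Φ.yoneda X)) := by
  have h := Φ.isYonedaExtension_counit (Φ.freeCocompletion.obj X)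
  have h2 := (Φ.isWeightedColimit_iff_rel_eq (Φ.mem_lowerStar_yoneda (Φ.phiObj X))).1 h
  refine Eq.trans h2 ?_
  rw [lowerStar_yoneda, lowerStar_yoneda]
  rfl

variable {Φ} in
-- It suffices to test on `ev`, which is $y_*$; there $y_*\circ\mu_*\circ y_*=y_*$ because `μ`
-- retracts `y`.
theorem tLe_comp_yoneda_of_retraction {X : TCat 𝕋} {μ : Φ.phiObj X ⟶ X}
    (hμ : Φ.yoneda X ≫ μ = 𝟙 X) : TLe (𝟙 (Φ.phiObj X)) (μ ≫ Φ.yoneda X) := by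
  rw [tLe_iff_lowerStar_le, lowerStar_eq_extension (h := 𝟙 _), 𝕋.le_extension, rel_id,
    ← lowerStar_yoneda, lowerStar_comp, ← 𝕋.kleisli_assoc, ← lowerStar_comp, hμ, lowerStar_id,
    (isDistributor_lowerStar _).kleisli_str]

variable {Φ} in
theorem comp_phiMap_yoneda_tLe {X : TCat 𝕋} {μ : Φ.phiObj (Φ.phiObj X) ⟶ Φ.phiObj X}
    (hμ : rel μ = 𝕋.kleisli (Φ.ev (Φ.phiObj X)) (lowerStar (Φ.yoneda X))) :
    TLe (μ ≫ Φ.phiMap (Φ.yoneda X)) (𝟙 _) := by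
  rw [tLe_iff_rel_le, rel_comp_phiMap, hμ, ← 𝕋.kleisli_assoc]
  exact (𝕋.kleisli_mono le_rfl (lowerStar_upperStar_le (Φ.yoneda X))).trans
    (Φ.isDistributor_ev (Φ.phiObj X)).1

theorem isKockZoberlein : IsKockZoberlein Φ.adjunction.toMonad where
  monotone f g h := tLe_iff_rel_le.2 (𝕋.kleisli_mono (le_refl (Φ.ev _)) h)
  map_unit_adj X := by
    constructor
    · rw [Φ.adjunction.toMonad.right_unit X]
      exact tLe_refl _
    · rw [show Φ.adjunction.toMonad.η.app X = Φ.yoneda X from Φ.adjunction_unit_app X]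
      exact comp_phiMap_yoneda_tLe (Φ.rel_mu X)
  adj_unit_map X := by
    have h := Φ.adjunction.toMonad.left_unit X
    constructor
    · rw [show Φ.adjunction.toMonad.η.app (Φ.adjunction.toMonad.obj X) =
        Φ.yoneda (Φ.phiObj X) from Φ.adjunction_unit_app _] at h ⊢
      exact tLe_comp_yoneda_of_retraction h
    · rw [h]
      exact tLe_refl _

/-! ### Monadicity -/

instance : Φ.inclusion.Faithful where
  map_injective h := Subtype.ext h

instance : (Monad.comparison Φ.adjunction).Full where
  map_surjective {A B} F :=
    ⟨⟨F.f, isCocontinuous_of_comp_eq A.separated (Φ.isYonedaExtension_counit A)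
      (Φ.isYonedaExtension_counit B) F.h⟩, rfl⟩

instance : (Monad.comparison Φ.adjunction).EssSurj where
  mem_essImage M := by
    -- The unit law makes the structure map a retraction of the Yoneda functor. This yields
    -- cocompleteness, and separation follows since `M.A` is a retract of a separated category.
    have h0 : Φ.yoneda M.A ≫ M.a = 𝟙 M.A := by
      have := M.unit
      rwa [show Φ.adjunction.toMonad.η.app M.A = Φ.yoneda M.A from
        Φ.adjunction_unit_app _] at this
    have h1 : Φ.IsYonedaExtension (𝟙 M.A) M.a := isYonedaExtension_of_retraction h0
    let A : Φ.CocomplSep :=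
      ⟨M.A, (Φ.isSeparated_phiObj M.A).of_retract _ _ h0, h1.isCocomplete⟩
    have h2 : Φ.inclusion.map (Φ.adjunction.counit.app A) = M.a :=
      A.separated.eq_of_lowerStar_eq ((Φ.isYonedaExtension_counit A).trans h1.symm)
    refine ⟨A, ⟨Monad.Algebra.isoMk (Iso.refl M.A) ?_⟩⟩
    change Φ.phiMap (𝟙 M.A) ≫ M.a = Φ.inclusion.map (Φ.adjunction.counit.app A) ≫ 𝟙 M.A
    rw [h2]
    exact congrArg (· ≫ M.a) (Φ.phi.map_id M.A)

theorem comparison_isEquivalence : (Monad.comparison Φ.adjunction).IsEquivalence where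

end DistributorClass

/-! ### An inclusion that is not full -/

variable (𝕋) in
/-- The class of all distributors. -/
def DistributorClass.all : DistributorClass 𝕋 where
  mem X Y φ := IsDistributor X Y φ
  isDistributor h := h
  ax1 f := isDistributor_upperStar f
  ax2_upper_comp f h := (isDistributor_upperStar f).kleisli h
  ax2_comp_upper f h := h.kleisli (isDistributor_upperStar f)
  ax2_comp_lower _ h h' := h.kleisli h'
  ax3 h _ := h

end

/-- The identity theory, whose categories are the categories enriched in the quantale. -/
def TopologicalTheory.identity (V : Type u) [CommMonoid V] [CompleteLattice V] [IsQuantale V] :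
    TopologicalTheory V where
  T := CategoryTheory.Monad.id (Type u)
  map_weakPullback _ _ x y h := ⟨⟨(x, y), h⟩, rfl, rfl⟩
  mul_weakPullback _ x _ h := ⟨x, rfl, h⟩
  ξ v := v
  ξ_unit _ := rfl
  ξ_mul _ := rfl
  ξ_one _ := rfl
  ξ_tensor _ := rfl
  ξ_mono _ _ h x := h x
  ξ_natural _ _ _ := rfl

section

variable {V : Type u} [CommMonoid V] [CompleteLattice V] [IsQuantale V]

theorem isDistributor_bot :
    IsDistributor (TCat.G (TopologicalTheory.identity V)) (TCat.G _) fun _ _ => ⊥ := by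
  refine ⟨(TopologicalTheory.kleisli_unit _ _).le, ?_⟩
  refine (TopologicalTheory.kleisli_le _).2 fun 𝔛 𝔶 z => ?_
  have h : (TopologicalTheory.identity V).Txi
      (fun (_ : (TopologicalTheory.identity V).obj PUnit.{u + 1}) (_ : PUnit.{u + 1}) => (⊥ : V))
      𝔛 𝔶 ≤ ⊥ := iSup₂_le fun _ _ => le_rfl
  refine (mul_le_mul' h le_rfl).trans ?_
  simp

/-- The empty category over the identity theory. -/
def emptyTCat (V : Type u) [CommMonoid V] [CompleteLattice V] [IsQuantale V] :
    TCat (TopologicalTheory.identity V) where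
  carrier := PEmpty.{u + 1}
  str _ x := x.elim
  unit_le _ x := x.elim
  comp_le _ x := x.elim

open DistributorClass in
-- The constant endofunctor of `ΦG` at the representable presheaf is tested on the colimit of the
-- empty diagram weighted by `⊥`. If it were preserved, the representable would lie below the
-- presheaf `⊥`, and the Yoneda lemma would give $k\le\bot$.
theorem not_full_inclusion_all (h1 : (1 : V) = ⊤) (h0 : (1 : V) ≠ ⊥) :
    ¬ (all (TopologicalTheory.identity V)).inclusion.Full := by
  intro hfull
  let Φ := all (TopologicalTheory.identity V)
  let G := TCat.G (TopologicalTheory.identity V)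
  let A : Φ.CocomplSep := Φ.freeCocompletion.obj G
  let c : A.toTCat.carrier := (Φ.yoneda G).toFun PUnit.unit
  let F : A.toTCat ⟶ A.toTCat :=
    -- Integrality $k=\top$ makes every constant map a functor.
    ⟨fun _ => c, fun _ _ => (le_top.trans_eq h1.symm).trans (A.toTCat.one_le_str c)⟩
  obtain ⟨⟨F', hF'⟩, hF⟩ := hfull.map_surjective (X := A) (Y := A) F
  obtain rfl : F' = F := hF
  let φ : (TopologicalTheory.identity V).Rel (emptyTCat V).carrier G.carrier := fun _ _ => ⊥
  have hφ : Φ.mem (emptyTCat V) G φ := ⟨fun x => PEmpty.elim x, fun x => PEmpty.elim x⟩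
  let h : emptyTCat V ⟶ A.toTCat := ⟨fun x => x.elim, fun _ x => x.elim⟩
  obtain ⟨g, hg⟩ := A.cocomplete _ _ φ h hφ
  have h2 := hF' _ _ φ h g hφ hg
  -- An extension along a weight out of the empty category satisfies no constraint, so it dominates
  -- every relation.
  have h3 : (fun _ _ => 1) ≤ lowerStar (g ≫ F) := by
    rw [h2, TopologicalTheory.le_extension]
    exact fun x => PEmpty.elim x
  have h4 := (h3 PUnit.unit (elt (Φ := Φ) (fun _ _ => ⊥) isDistributor_bot)).trans_eq
    (lowerStar_apply (g ≫ F) _ _)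
  have h5 := congrFun (congrFun (Φ.lowerStar_yoneda G) PUnit.unit)
    (elt (Φ := Φ) (fun _ _ => ⊥) isDistributor_bot)
  have h6 := (lowerStar_apply (Φ.yoneda G) _ _).symm.trans h5
  exact h0 (le_bot_iff.1 (h4.trans h6.le))

end

/-! ### Frames as quantales. -/

/-- The multiplicative structure of a frame whose tensor is the meet. -/
abbrev frameCommMonoid (V : Type u) [Order.Frame V] : CommMonoid V where
  mul a b := a ⊓ b
  mul_assoc := inf_assoc
  one := ⊤
  one_mul := top_inf_eq
  mul_one := inf_top_eq
  mul_comm := inf_comm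

theorem frame_isQuantale (V : Type u) [Order.Frame V] :
    letI := frameCommMonoid V
    IsQuantale V :=
  letI := frameCommMonoid V
  { mul_sSup_distrib := fun _ _ => inf_sSup_eq
    sSup_mul_distrib := fun _ _ => sSup_inf_eq }


theorem mainTheorem8 :
    (∀ (V : Type u) [CommMonoid V] [CompleteLattice V] [IsQuantale V]
      (𝕋 : TopologicalTheory V) (Φ : DistributorClass 𝕋),
      ∃ (hs : ∀ X : TCat 𝕋, IsSeparated (Φ.phiObj X))
        (hc : ∀ X : TCat 𝕋, Φ.IsCocomplete (Φ.phiObj X))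
        (hm : ∀ {X Y : TCat 𝕋} (f : X ⟶ Y), Φ.IsCocontinuous (Φ.phiMap f))
        (adj : Φ.reflector hs hc hm ⊣ Φ.inclusion),
        (∀ X : TCat 𝕋, adj.toMonad.η.app X = Φ.yoneda X) ∧
        (∀ (X : TCat 𝕋) (Ψ : (Φ.phiObj (Φ.phiObj X)).carrier),
          DistributorClass.val ((adj.toMonad.μ.app X).toFun Ψ) =
            𝕋.kleisli (DistributorClass.val Ψ) (lowerStar (Φ.yoneda X))) ∧
        IsKockZoberlein adj.toMonad ∧
        (CategoryTheory.Monad.comparison adj).IsEquivalence) ∧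
    (∃ (V : Type u) (_ : CommMonoid V) (_ : CompleteLattice V) (_ : IsQuantale V)
      (𝕋 : TopologicalTheory V) (Φ : DistributorClass 𝕋), ¬ Φ.inclusion.Full) := by
  constructor
  · intro V _ _ _ 𝕋 Φ
    refine ⟨Φ.isSeparated_phiObj, Φ.isCocomplete_phiObj, fun f => Φ.isCocontinuous_phiMap f,
      Φ.adjunction, Φ.adjunction_unit_app, fun X Ψ => ?_, Φ.isKockZoberlein,
      Φ.comparison_isEquivalence⟩
    funext 𝔵 _
    exact congrFun (congrFun (Φ.rel_mu X) 𝔵) Ψ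
  -- The powerset of a point is the two-element frame, placed in the required universe; its
  -- categories over the identity theory are preordered sets.
  · let _ : CommMonoid (Set PUnit.{u + 1}) := frameCommMonoid _
    have := frame_isQuantale (Set PUnit.{u + 1})
    exact ⟨Set PUnit.{u + 1}, inferInstance, inferInstance, inferInstance,
      TopologicalTheory.identity _, DistributorClass.all _,
      not_full_inclusion_all rfl (top_ne_bot (α := Set PUnit.{u + 1}))⟩
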